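/- Let $M$ be a smooth (Hausdorff, second countable, finite-dimensional) manifold and let $\mathcal{M}$ be an $N$-manifold with body $M$: a sheaf $C^\infty_{\mathcal M}$ on $M$ of $\mathbb{Z}$-graded, graded-commutative rings that vanishes in negative degrees, whose degree $0$ part is the sheaf $C^\infty_M$ of smooth functions, and which near every point is freely generated over $C^\infty_M$, as a graded-commutative algebra, by homogeneous coordinates of positive degree, finitely many in each degree. Let $\pi_{\mathcal M}:\mathcal M\to M$ be the projection whose pullback $\pi_{\mathcal M}^*$ includes $C^\infty_M$ as the degree $0$ functions on $\mathcal{M}$, and let $0_{\mathcal M}:M\to\mathcal M$ be the zero embedding, whose pullback is the identity on degree $0$ functions and annihilates functions of positive degree. A vector bundle $\mathcal B$ over $\mathcal M$ is a locally free sheaf $\Gamma(\mathcal B)$ of $\mathbb{Z}$-graded $C^\infty_{\mathcal M}$-modules, i.e. near every point it is a direct sum, as a sheaf of graded modules, of copies of $C^\infty_{\mathcal M}$ with $\mathrm{rank}_i(\mathcal B)<\infty$ generators in each degree $i\in\mathbb Z$. Suppose that $\mathcal B$ is degree-bounded ($\mathrm{rank}_i(\mathcal B)=0$ for all $i<a$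 and all $i>b$, for some integers $a,b$) or semibounded ($\mathrm{rank}_i(\mathcal B)=0$ for all $i<a$, or for all $i>b$, for some integer $a$ or $b$). Let $\mathcal E:=0_{\mathcal M}^*\mathcal B$, the sheaf of graded modules associated to $C^\infty_M\otimes_{C^\infty_{\mathcal M}}\Gamma(\mathcal B)$, be the standard graded vector bundle associated to $\mathcal B$. Then $\mathcal E$ is a graded vector bundle over $M$ whose rank in each degree $i$ is $\mathrm{rank}_i(\mathcal B)$, and there exists a (not canonical) isomorphism $\mathcal B\cong\pi_{\mathcal M}^*\mathcal E$ of vector bundles over $\mathcal M$, that is, a degree-preserving $C^\infty_{\mathcal M}$-linear isomorphism of $\Gamma(\mathcal B)$ with the sheaf associated to $C^\infty_{\mathcal M}\otimes_{C^\infty_M}\Gamma(\mathcal E)$. -/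

import Mathlib

open scoped Manifold ContDiff
open TopologicalSpace (Opens)

universe u

noncomputable section

/-! ## Graded sheaves, graded rings and graded modules

Graded objects are families indexed by the degree `k : ℤ`. Products are given in the form
`mul (h : i + j = k) a b`, for `a` of degree `i` and `b` of degree `j`, so that the laws need no
transport between equal degrees. -/

/-- A `ℤ`-graded presheaf of abelian groups on `X`. -/
structure GrPresheaf (X : Type u) [TopologicalSpace X] where
  sec : ℤ → Opens X → Type u
  [grp : ∀ k U, AddCommGroup (sec k U)]
  res : ∀ {k : ℤ} {U V : Opens X}, V ≤ U → sec k U →+ sec k V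
  res_self : ∀ {k : ℤ} {U : Opens X} (a : sec k U), res le_rfl a = a
  res_res : ∀ {k : ℤ} {U V W : Opens X} (h : V ≤ U) (h' : W ≤ V) (a : sec k U),
    res h' (res h a) = res (h'.trans h) a

attribute [instance] GrPresheaf.grp

/-- The sheaf condition, in every degree. -/
def GrPresheaf.IsSheaf {X : Type u} [TopologicalSpace X] (P : GrPresheaf X) : Prop :=
  ∀ (k : ℤ) (ι : Type u) (U : ι → Opens X) (s : ∀ a, P.sec k (U a)),
    (∀ a b, P.res (V := U a ⊓ U b) inf_le_left (s a) = P.res inf_le_right (s b)) →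
    ∃! t : P.sec k (⨆ a, U a), ∀ a, P.res (le_iSup U a) t = s a

/-- A sheaf of `ℤ`-graded (associative, unital) rings on `X`. -/
structure GrRingSheaf (X : Type u) [TopologicalSpace X] extends GrPresheaf X where
  isSheaf : toGrPresheaf.IsSheaf
  one : ∀ U, sec 0 U
  mul : ∀ {i j k : ℤ} (_ : i + j = k) {U : Opens X}, sec i U →+ sec j U →+ sec k U
  one_mul : ∀ {k : ℤ} {U : Opens X} (a : sec k U), mul (zero_add k) (one U) a = a
  mul_one : ∀ {k : ℤ} {U : Opens X} (a : sec k U), mul (add_zero k) a (one U) = a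
  mul_assoc : ∀ {i j k ij jk l : ℤ} (h₁ : i + j = ij) (h₂ : ij + k = l) (h₃ : j + k = jk)
    (h₄ : i + jk = l) {U : Opens X} (a : sec i U) (b : sec j U) (c : sec k U),
    mul h₂ (mul h₁ a b) c = mul h₄ a (mul h₃ b c)
  res_one : ∀ {U V : Opens X} (h : V ≤ U), res h (one U) = one V
  res_mul : ∀ {i j k : ℤ} (h : i + j = k) {U V : Opens X} (hV : V ≤ U) (a : sec i U)
    (b : sec j U), res hV (mul h a b) = mul h (res hV a) (res hV b)

/-- A morphism `O → O'` of sheaves of graded rings over the identity of `X`. -/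
structure GrRingSheaf.Hom {X : Type u} [TopologicalSpace X] (O O' : GrRingSheaf X) where
  toFun : ∀ {k : ℤ} {U : Opens X}, O.sec k U →+ O'.sec k U
  map_one : ∀ U, toFun (O.one U) = O'.one U
  map_mul : ∀ {i j k : ℤ} (h : i + j = k) {U : Opens X} (a : O.sec i U) (b : O.sec j U),
    toFun (O.mul h a b) = O'.mul h (toFun a) (toFun b)
  map_res : ∀ {k : ℤ} {U V : Opens X} (h : V ≤ U) (a : O.sec k U),
    toFun (O.res h a) = O'.res h (toFun a)

/-- A presheaf of graded (left) modules over a sheaf of graded rings. -/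
structure GrModPresheaf {X : Type u} [TopologicalSpace X] (O : GrRingSheaf X) extends
    GrPresheaf X where
  smul : ∀ {i j k : ℤ} (_ : i + j = k) {U : Opens X}, O.sec i U →+ sec j U →+ sec k U
  one_smul : ∀ {k : ℤ} {U : Opens X} (s : sec k U), smul (zero_add k) (O.one U) s = s
  mul_smul : ∀ {i j k ij jk l : ℤ} (h₁ : i + j = ij) (h₂ : ij + k = l) (h₃ : j + k = jk)
    (h₄ : i + jk = l) {U : Opens X} (a : O.sec i U) (b : O.sec j U) (s : sec k U),
    smul h₂ (O.mul h₁ a b) s = smul h₄ a (smul h₃ b s)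
  res_smul : ∀ {i j k : ℤ} (h : i + j = k) {U V : Opens X} (hV : V ≤ U) (a : O.sec i U)
    (s : sec j U), res hV (smul h a s) = smul h (O.res hV a) (res hV s)

/-- A sheaf of graded modules over a sheaf of graded rings. -/
structure GrModSheaf {X : Type u} [TopologicalSpace X] (O : GrRingSheaf X) extends
    GrModPresheaf O where
  isSheaf : toGrPresheaf.IsSheaf

/-- An isomorphism of sheaves of graded `O`-modules: bijective in every degree, `O`-linear and
compatible with restriction. -/
structure GrModSheaf.Iso {X : Type u} [TopologicalSpace X] {O : GrRingSheaf X}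
    (F G : GrModSheaf O) where
  toEquiv : ∀ (k : ℤ) (U : Opens X), F.sec k U ≃+ G.sec k U
  map_smul : ∀ {i j k : ℤ} (h : i + j = k) {U : Opens X} (a : O.sec i U) (s : F.sec j U),
    toEquiv k U (F.smul h a s) = G.smul h a (toEquiv j U s)
  map_res : ∀ {k : ℤ} {U V : Opens X} (h : V ≤ U) (s : F.sec k U),
    toEquiv k V (F.res h s) = G.res h (toEquiv k U s)

/-- Homogeneous sections `e ⟨i, p⟩` over `U`, of degree `i` for `p < r i`, form a frame of `F`:
over every open subset of `U` they are linearly independent over `O`, and every homogeneous section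
of `F` is locally a (finite) `O`-linear combination of them. In other words, they identify `F` over
`U` with the direct sum, in the category of sheaves of graded `O`-modules, of copies of `O`, of
which `r i` are generated in degree `i`. -/
def GrModSheaf.IsFrame {X : Type u} [TopologicalSpace X] {O : GrRingSheaf X} (F : GrModSheaf O)
    (U : Opens X) (r : ℤ → ℕ) (e : ∀ j : (Σ i : ℤ, Fin (r i)), F.sec j.1 U) : Prop :=
  ∀ (V : Opens X) (hV : V ≤ U) (k : ℤ),
    (∀ (t : Finset (Σ i : ℤ, Fin (r i))) (c : ∀ j : (Σ i : ℤ, Fin (r i)), O.sec (k - j.1) V),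
      ∑ j ∈ t, F.smul (sub_add_cancel k j.1) (c j) (F.res hV (e j)) = 0 → ∀ j ∈ t, c j = 0) ∧
    (∀ s : F.sec k V, ∀ x ∈ V, ∃ (W : Opens X) (hW : W ≤ V), x ∈ W ∧
      ∃ (t : Finset (Σ i : ℤ, Fin (r i))) (c : ∀ j : (Σ i : ℤ, Fin (r i)), O.sec (k - j.1) W),
        F.res hW s = ∑ j ∈ t, F.smul (sub_add_cancel k j.1) (c j) (F.res (hW.trans hV) (e j)))

/-- `F` is locally free; `r x i` is the rank in degree `i` near the point `x`. -/
def GrModSheaf.IsLocallyFree {X : Type u} [TopologicalSpace X] {O : GrRingSheaf X}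
    (F : GrModSheaf O) (r : X → ℤ → ℕ) : Prop :=
  ∀ x : X, ∃ U : Opens X, x ∈ U ∧ ∃ e, F.IsFrame U (r x) e

/-! ## Extension of scalars -/

section ExtendScalars

variable {X : Type u} [TopologicalSpace X] {O O' : GrRingSheaf X}

/-- Generators `a ⊗ s` of degree `k` of `O'(U) ⊗ F(U)`. -/
structure TensorGen (O' : GrRingSheaf X) (F : GrModSheaf O) (k : ℤ) (U : Opens X) :
    Type u where
  i : ℤ
  j : ℤ
  deg : i + j = k
  coeff : O'.sec i U
  val : F.sec j U

/-- The relations of the tensor product over `O(U)`; each of the listed elements is to be zero. -/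
inductive TensorRel (φ : O.Hom O') (F : GrModSheaf O) (k : ℤ) (U : Opens X) :
    FreeAbelianGroup (TensorGen O' F k U) → Prop
  | add_left {i j : ℤ} (h : i + j = k) (a b : O'.sec i U) (s : F.sec j U) :
      TensorRel φ F k U (.of ⟨i, j, h, a + b, s⟩ - .of ⟨i, j, h, a, s⟩ - .of ⟨i, j, h, b, s⟩)
  | add_right {i j : ℤ} (h : i + j = k) (a : O'.sec i U) (s t : F.sec j U) :
      TensorRel φ F k U (.of ⟨i, j, h, a, s + t⟩ - .of ⟨i, j, h, a, s⟩ - .of ⟨i, j, h, a, t⟩)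
  | balance {i l j il lj : ℤ} (h₁ : i + l = il) (h₂ : il + j = k) (h₃ : l + j = lj)
      (h₄ : i + lj = k) (a : O'.sec i U) (r : O.sec l U) (s : F.sec j U) :
      TensorRel φ F k U
        (.of ⟨il, j, h₂, O'.mul h₁ a (φ.toFun r), s⟩ - .of ⟨i, lj, h₄, a, F.smul h₃ r s⟩)

/-- The degree `k` part of the tensor product `O'(U) ⊗ F(U)` over the graded ring `O(U)`. -/
def TensorSec (φ : O.Hom O') (F : GrModSheaf O) (k : ℤ) (U : Opens X) : Type u :=
  FreeAbelianGroup (TensorGen O' F k U) ⧸ AddSubgroup.closure {z | TensorRel φ F k U z}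

instance (φ : O.Hom O') (F : GrModSheaf O) (k : ℤ) (U : Opens X) :
    AddCommGroup (TensorSec φ F k U) :=
  inferInstanceAs (AddCommGroup (_ ⧸ AddSubgroup.closure {z | TensorRel φ F k U z}))

namespace TensorSec

variable (φ : O.Hom O') (F : GrModSheaf O)

/-- The element `a ⊗ s`. -/
def tmul {i j k : ℤ} (h : i + j = k) {U : Opens X} (a : O'.sec i U) (s : F.sec j U) :
    TensorSec φ F k U :=
  QuotientAddGroup.mk (FreeAbelianGroup.of ⟨i, j, h, a, s⟩)

variable {F}

lemma mk_eq_zero {k : ℤ} {U : Opens X} {z : FreeAbelianGroup (TensorGen O' F k U)}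
    (h : TensorRel φ F k U z) : (QuotientAddGroup.mk z : TensorSec φ F k U) = 0 :=
  (QuotientAddGroup.eq_zero_iff z).2 (AddSubgroup.subset_closure h)

lemma tmul_add_left {i j k : ℤ} (h : i + j = k) {U : Opens X} (a b : O'.sec i U)
    (s : F.sec j U) : tmul φ F h (a + b) s = tmul φ F h a s + tmul φ F h b s := by
  have := mk_eq_zero φ (TensorRel.add_left (φ := φ) (F := F) h a b s)
  rw [QuotientAddGroup.mk_sub, QuotientAddGroup.mk_sub, sub_sub, sub_eq_zero] at this
  exact this

lemma tmul_add_right {i j k : ℤ} (h : i + j = k) {U : Opens X} (a : O'.sec i U)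
    (s t : F.sec j U) : tmul φ F h a (s + t) = tmul φ F h a s + tmul φ F h a t := by
  have := mk_eq_zero φ (TensorRel.add_right (φ := φ) (F := F) h a s t)
  rw [QuotientAddGroup.mk_sub, QuotientAddGroup.mk_sub, sub_sub, sub_eq_zero] at this
  exact this

lemma tmul_balance {i l j il lj k : ℤ} (h₁ : i + l = il) (h₂ : il + j = k) (h₃ : l + j = lj)
    (h₄ : i + lj = k) {U : Opens X} (a : O'.sec i U) (r : O.sec l U) (s : F.sec j U) :
    tmul φ F h₂ (O'.mul h₁ a (φ.toFun r)) s = tmul φ F h₄ a (F.smul h₃ r s) := by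
  have := mk_eq_zero φ (TensorRel.balance (φ := φ) (F := F) h₁ h₂ h₃ h₄ a r s)
  rw [QuotientAddGroup.mk_sub, sub_eq_zero] at this
  exact this

/-- Homomorphisms out of the tensor product. -/
def lift {k : ℤ} {U : Opens X} {A : Type u} [AddCommGroup A]
    (f : ∀ {i j : ℤ}, i + j = k → O'.sec i U → F.sec j U → A)
    (hl : ∀ {i j : ℤ} (h : i + j = k) a b s, f h (a + b) s = f h a s + f h b s)
    (hr : ∀ {i j : ℤ} (h : i + j = k) a s t, f h a (s + t) = f h a s + f h a t)
    (hb : ∀ {i l j il lj : ℤ} (h₁ : i + l = il) (h₂ : il + j = k) (h₃ : l + j = lj)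
      (h₄ : i + lj = k) a r s, f h₂ (O'.mul h₁ a (φ.toFun r)) s = f h₄ a (F.smul h₃ r s)) :
    TensorSec φ F k U →+ A :=
  QuotientAddGroup.lift _ (FreeAbelianGroup.lift fun g => f g.deg g.coeff g.val) <| by
    rw [AddSubgroup.closure_le]
    rintro z hz
    change FreeAbelianGroup.lift _ z = 0
    cases hz with
    | add_left h a b s => simp [hl]
    | add_right h a s t => simp [hr]
    | balance h₁ h₂ h₃ h₄ a r s => simp [hb h₁ h₂ h₃ h₄]

lemma lift_tmul {k : ℤ} {U : Opens X} {A : Type u} [AddCommGroup A]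
    (f : ∀ {i j : ℤ}, i + j = k → O'.sec i U → F.sec j U → A) (hl) (hr) (hb)
    {i j : ℤ} (h : i + j = k) (a : O'.sec i U) (s : F.sec j U) :
    lift φ f hl hr hb (tmul φ F h a s) = f h a s :=
  FreeAbelianGroup.lift_apply_of _ _

lemma hom_ext {k : ℤ} {U : Opens X} {A : Type u} [AddCommGroup A]
    {f g : TensorSec φ F k U →+ A}
    (H : ∀ {i j : ℤ} (h : i + j = k) (a : O'.sec i U) (s : F.sec j U),
      f (tmul φ F h a s) = g (tmul φ F h a s)) : f = g := by
  apply QuotientAddGroup.addMonoidHom_ext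
  apply FreeAbelianGroup.lift_ext
  rintro ⟨i, j, h, a, s⟩
  exact H h a s

variable (F)

/-- Restriction: `a ⊗ s ↦ a|_V ⊗ s|_V`. -/
def res {k : ℤ} {U V : Opens X} (hV : V ≤ U) : TensorSec φ F k U →+ TensorSec φ F k V :=
  lift φ (fun h a s => tmul φ F h (O'.res hV a) (F.res hV s))
    (fun h a b s => by rw [map_add, tmul_add_left])
    (fun h a s t => by rw [map_add, tmul_add_right])
    (fun h₁ h₂ h₃ h₄ a r s => by
      rw [O'.res_mul, ← φ.map_res, F.res_smul, tmul_balance φ h₁ h₂ h₃ h₄])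

lemma res_tmul {i j k : ℤ} (h : i + j = k) {U V : Opens X} (hV : V ≤ U) (a : O'.sec i U)
    (s : F.sec j U) :
    res φ F hV (tmul φ F h a s) = tmul φ F h (O'.res hV a) (F.res hV s) :=
  lift_tmul ..

/-- The action of `b`, for `b` fixed: `a ⊗ s ↦ (b * a) ⊗ s`. -/
def smulAux {l m k : ℤ} (hk : l + m = k) {U : Opens X} (b : O'.sec l U) :
    TensorSec φ F m U →+ TensorSec φ F k U :=
  lift φ (fun {i j} h a s => tmul φ F (i := l + i) (by omega) (O'.mul rfl b a) s)
    (fun h a b s => by rw [map_add, tmul_add_left])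
    (fun h a s t => by rw [tmul_add_right])
    (fun {i l' j il lj} h₁ h₂ h₃ h₄ a r s => by
      rw [← tmul_balance φ (il := l + il) (by omega) (by omega) h₃ (by omega)]
      rw [O'.mul_assoc rfl (by omega) h₁ rfl])

lemma smulAux_tmul {l i m il j k : ℤ} (hk : l + m = k) (h : i + j = m) (h₁ : l + i = il)
    (h₂ : il + j = k) {U : Opens X} (b : O'.sec l U) (a : O'.sec i U) (s : F.sec j U) :
    smulAux φ F hk b (tmul φ F h a s) = tmul φ F h₂ (O'.mul h₁ b a) s := by
  subst h₁
  exact lift_tmul ..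

/-- The action of `O'(U)` on the tensor product. -/
def smul {l m k : ℤ} (hk : l + m = k) {U : Opens X} :
    O'.sec l U →+ TensorSec φ F m U →+ TensorSec φ F k U :=
  AddMonoidHom.mk' (smulAux φ F hk) fun b c => hom_ext φ fun {i j} h a s => by
    rw [AddMonoidHom.add_apply]
    have h₂ : l + i + j = k := by omega
    rw [smulAux_tmul φ F hk h rfl h₂, smulAux_tmul φ F hk h rfl h₂,
      smulAux_tmul φ F hk h rfl h₂, map_add, AddMonoidHom.add_apply, tmul_add_left]

lemma smul_tmul {l i m il j k : ℤ} (hk : l + m = k) (h : i + j = m) (h₁ : l + i = il)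
    (h₂ : il + j = k) {U : Opens X} (b : O'.sec l U) (a : O'.sec i U) (s : F.sec j U) :
    smul φ F hk b (tmul φ F h a s) = tmul φ F h₂ (O'.mul h₁ b a) s :=
  smulAux_tmul φ F hk h h₁ h₂ b a s

end TensorSec

/-- The presheaf of graded `O'`-modules `U ↦ O'(U) ⊗ F(U)`, the tensor product over `O(U)`. -/
def tensorPresheaf (φ : O.Hom O') (F : GrModSheaf O) : GrModPresheaf O' where
  sec := TensorSec φ F
  res := TensorSec.res φ F
  res_self {k U} z := by
    have : TensorSec.res φ F (k := k) (le_refl U) = AddMonoidHom.id _ :=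
      TensorSec.hom_ext φ fun h a s => by
        rw [TensorSec.res_tmul, O'.res_self, F.res_self]; rfl
    rw [this]; rfl
  res_res {k U V W} h h' z := by
    have : (TensorSec.res φ F (k := k) h').comp (TensorSec.res φ F h)
        = TensorSec.res φ F (h'.trans h) :=
      TensorSec.hom_ext φ fun _ a s => by
        rw [AddMonoidHom.comp_apply, TensorSec.res_tmul, TensorSec.res_tmul, TensorSec.res_tmul,
          O'.res_res, F.res_res]
    exact DFunLike.congr_fun this z
  smul := TensorSec.smul φ F
  one_smul {k U} z := by
    have : TensorSec.smul φ F (zero_add k) (O'.one U) = AddMonoidHom.id _ :=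
      TensorSec.hom_ext φ fun {i j} h a s => by
        rw [TensorSec.smul_tmul φ F _ h (zero_add i) h, O'.one_mul]; rfl
    rw [this]; rfl
  mul_smul {l m k lm mk n} h₁ h₂ h₃ h₄ U b c z := by
    have : TensorSec.smul φ F h₂ (O'.mul h₁ b c)
        = (TensorSec.smul φ F h₄ b).comp (TensorSec.smul φ F h₃ c) :=
      TensorSec.hom_ext φ fun {i j} h a s => by
        rw [AddMonoidHom.comp_apply,
          TensorSec.smul_tmul φ F h₂ h (il := lm + i) rfl (by omega),
          TensorSec.smul_tmul φ F h₃ h (il := m + i) rfl (by omega),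
          TensorSec.smul_tmul φ F h₄ _ (il := lm + i) (by omega) (by omega),
          O'.mul_assoc h₁ rfl rfl (by omega)]
    exact DFunLike.congr_fun this z
  res_smul {l m k} h U V hV b z := by
    have : (TensorSec.res φ F hV).comp (TensorSec.smul φ F h b)
        = (TensorSec.smul φ F h (O'.res hV b)).comp (TensorSec.res φ F hV) :=
      TensorSec.hom_ext φ fun {i j} h' a s => by
        have h₂ : l + i + j = k := by omega
        rw [AddMonoidHom.comp_apply, AddMonoidHom.comp_apply,
          TensorSec.smul_tmul φ F h h' rfl h₂, TensorSec.res_tmul, TensorSec.res_tmul,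
          TensorSec.smul_tmul φ F h h' rfl h₂, O'.res_mul]
    exact DFunLike.congr_fun this z

end ExtendScalars

/-! ## Sheafification -/

section Sheafify

variable {X : Type u} [TopologicalSpace X]

/-- The open neighbourhoods of a point, ordered by reverse inclusion. -/
abbrev Nbhd (x : X) : Type u := {U : Opens X // x ∈ U}ᵒᵈ

instance (x : X) : IsDirectedOrder (Nbhd x) :=
  ⟨fun U V => ⟨OrderDual.toDual ⟨U.ofDual.1 ⊓ V.ofDual.1, U.ofDual.2, V.ofDual.2⟩,
    (inf_le_left : U.ofDual.1 ⊓ V.ofDual.1 ≤ U.ofDual.1),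
    (inf_le_right : U.ofDual.1 ⊓ V.ofDual.1 ≤ V.ofDual.1)⟩⟩

instance (x : X) : Nonempty (Nbhd x) := ⟨OrderDual.toDual ⟨⊤, trivial⟩⟩

open Classical in
/-- The stalk at `x` of the degree `k` part of a graded presheaf. -/
def GrPresheaf.Stalk (P : GrPresheaf X) (k : ℤ) (x : X) : Type u :=
  AddCommGroup.DirectLimit (fun U : Nbhd x => P.sec k U.ofDual.1)
    (fun _ _ h => P.res (k := k) h)

namespace GrPresheaf

open Classical in
instance (P : GrPresheaf X) (k : ℤ) (x : X) : AddCommGroup (P.Stalk k x) :=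
  AddCommGroup.DirectLimit.addCommGroup (fun U : Nbhd x => P.sec k U.ofDual.1)
    (fun _ _ h => P.res (k := k) h)

variable (P : GrPresheaf X)

open Classical in
/-- The germ at `x` of a section. -/
def germ {k : ℤ} {x : X} {U : Opens X} (hx : x ∈ U) : P.sec k U →+ P.Stalk k x :=
  AddCommGroup.DirectLimit.of (fun U : Nbhd x => P.sec k U.ofDual.1)
    (fun _ _ h => P.res (k := k) h) (OrderDual.toDual ⟨U, hx⟩)

lemma germ_res {k : ℤ} {x : X} {U V : Opens X} (hV : V ≤ U) (hx : x ∈ V) (p : P.sec k U) :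
    P.germ hx (P.res hV p) = P.germ (hV hx) p := by
  classical
  exact AddCommGroup.DirectLimit.of_f (G := fun U : Nbhd x => P.sec k U.ofDual.1)
    (f := fun _ _ h => P.res (k := k) h)
    (i := OrderDual.toDual ⟨U, hV hx⟩) (j := OrderDual.toDual ⟨V, hx⟩) hV p

lemma exists_germ {k : ℤ} {x : X} (z : P.Stalk k x) :
    ∃ (U : Opens X) (hx : x ∈ U) (p : P.sec k U), P.germ hx p = z := by
  classical
  induction z using AddCommGroup.DirectLimit.induction_on with
  | ih U p => exact ⟨U.ofDual.1, U.ofDual.2, p, rfl⟩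

open Classical in
/-- Homomorphisms out of a stalk. -/
def stalkLift {k : ℤ} {x : X} {A : Type u} [AddCommGroup A]
    (f : ∀ (U : Opens X), x ∈ U → P.sec k U →+ A)
    (hf : ∀ {U V : Opens X} (h : V ≤ U) (hx : x ∈ V) (p : P.sec k U),
      f V hx (P.res h p) = f U (h hx) p) : P.Stalk k x →+ A :=
  AddCommGroup.DirectLimit.lift (fun U : Nbhd x => P.sec k U.ofDual.1)
    (fun _ _ h => P.res (k := k) h) A (fun U => f U.ofDual.1 U.ofDual.2)
    (fun _ V h p => hf h V.ofDual.2 p)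

lemma stalkLift_germ {k : ℤ} {x : X} {A : Type u} [AddCommGroup A]
    (f : ∀ (U : Opens X), x ∈ U → P.sec k U →+ A) (hf)
    {U : Opens X} (hx : x ∈ U) (p : P.sec k U) :
    P.stalkLift f hf (P.germ hx p) = f U hx p := by
  classical
  exact AddCommGroup.DirectLimit.lift_of (G := fun U : Nbhd x => P.sec k U.ofDual.1)
    (f := fun _ _ h => P.res (k := k) h) A (fun U => f U.ofDual.1 U.ofDual.2) _
    (OrderDual.toDual ⟨U, hx⟩) p

/-- Sections over `U` of the sheaf associated to `P`: families of germs that are locally given by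
sections of `P`. -/
def sheafSec (k : ℤ) (U : Opens X) : AddSubgroup (∀ x : U, P.Stalk k x.1) where
  carrier := {s | ∀ x : U, ∃ (V : Opens X) (_ : x.1 ∈ V) (hV : V ≤ U) (p : P.sec k V),
    ∀ (y : X) (hy : y ∈ V), s ⟨y, hV hy⟩ = P.germ hy p}
  zero_mem' x := ⟨U, x.2, le_rfl, 0, fun y hy => by simp⟩
  add_mem' {s t} hs ht x := by
    obtain ⟨V, hxV, hV, p, hp⟩ := hs x
    obtain ⟨W, hxW, hW, q, hq⟩ := ht x
    refine ⟨V ⊓ W, ⟨hxV, hxW⟩, inf_le_left.trans hV,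
      P.res inf_le_left p + P.res inf_le_right q, fun y hy => ?_⟩
    rw [map_add, germ_res, germ_res, Pi.add_apply, hp y hy.1, hq y hy.2]
  neg_mem' {s} hs x := by
    obtain ⟨V, hxV, hV, p, hp⟩ := hs x
    exact ⟨V, hxV, hV, -p, fun y hy => by rw [map_neg, Pi.neg_apply, hp y hy]⟩

/-- The sheaf associated to a graded presheaf. -/
def sheafify : GrPresheaf X where
  sec k U := P.sheafSec k U
  res {k U V} h :=
    { toFun := fun s => ⟨fun x => s.1 ⟨x.1, h x.2⟩, fun x => by
        obtain ⟨W, hxW, hW, p, hp⟩ := s.2 ⟨x.1, h x.2⟩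
        refine ⟨W ⊓ V, ⟨hxW, x.2⟩, inf_le_right, P.res inf_le_left p, fun y hy => ?_⟩
        rw [germ_res]
        exact hp y hy.1⟩
      map_zero' := rfl
      map_add' := fun _ _ => rfl }
  res_self _ := rfl
  res_res _ _ _ := rfl

lemma sheafify_isSheaf : P.sheafify.IsSheaf := by
  intro k ι U s hs
  have hs' : ∀ a b (y : X) (ha : y ∈ U a) (hb : y ∈ U b),
      (s a).1 ⟨y, ha⟩ = (s b).1 ⟨y, hb⟩ := fun a b y ha hb =>
    congrFun (congrArg Subtype.val (hs a b)) ⟨y, ha, hb⟩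
  have hx : ∀ x : (⨆ a, U a : Opens X), ∃ a, x.1 ∈ U a := fun x => Opens.mem_iSup.1 x.2
  choose a ha using hx
  refine ⟨⟨fun x => (s (a x)).1 ⟨x.1, ha x⟩, fun x => ?_⟩, fun b => ?_, fun t ht => ?_⟩
  · obtain ⟨V, hxV, hV, p, hp⟩ := (s (a x)).2 ⟨x.1, ha x⟩
    exact ⟨V, hxV, hV.trans (le_iSup U _), p, fun y hy => by
      rw [← hp y hy]; exact hs' _ _ _ _ _⟩
  · exact Subtype.ext (funext fun x => hs' _ _ _ _ _)
  · exact Subtype.ext (funext fun x => by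
      have := congrFun (congrArg Subtype.val (ht (a x))) ⟨x.1, ha x⟩
      exact this)

end GrPresheaf

namespace GrModPresheaf

variable {O : GrRingSheaf X} (P : GrModPresheaf O)

/-- The action of `a ∈ O(U)` on the stalk at a point of `U`. -/
def stalkSmul {i j k : ℤ} (h : i + j = k) {U : Opens X} (a : O.sec i U) {x : X} (hx : x ∈ U) :
    P.Stalk j x →+ P.Stalk k x :=
  P.stalkLift
    (fun V hV => (P.germ (U := U ⊓ V) ⟨hx, hV⟩).comp
      ((P.smul h (O.res inf_le_left a)).comp (P.res inf_le_right)))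
    (fun {V W} hWV hxW p => by
      simp only [AddMonoidHom.comp_apply]
      rw [← P.germ_res (inf_le_inf_left U hWV) ⟨hx, hxW⟩, P.res_smul, O.res_res, P.res_res,
        P.res_res])

lemma stalkSmul_germ {i j k : ℤ} (h : i + j = k) {U V : Opens X} (a : O.sec i U) {x : X}
    (hx : x ∈ U) (hV : V ≤ U) (hxV : x ∈ V) (p : P.sec j V) :
    P.stalkSmul h a hx (P.germ hxV p) = P.germ hxV (P.smul h (O.res hV a) p) := by
  rw [stalkSmul, GrPresheaf.stalkLift_germ]
  simp only [AddMonoidHom.comp_apply]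
  rw [← P.germ_res (U := V) (V := U ⊓ V) inf_le_right ⟨hx, hxV⟩, P.res_smul, O.res_res]

lemma exists_germ_le {k : ℤ} {x : X} {U : Opens X} (hx : x ∈ U) (z : P.Stalk k x) :
    ∃ (V : Opens X) (_ : V ≤ U) (hxV : x ∈ V) (p : P.sec k V), P.germ hxV p = z := by
  obtain ⟨V, hxV, p, rfl⟩ := P.exists_germ z
  exact ⟨U ⊓ V, inf_le_left, ⟨hx, hxV⟩, P.res inf_le_right p, P.germ_res _ _ _⟩

/-- The sheaf of graded modules associated to a presheaf of graded modules; a section of `O` acts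
on families of germs pointwise. -/
def sheafify : GrModSheaf O where
  toGrPresheaf := P.toGrPresheaf.sheafify
  isSheaf := P.toGrPresheaf.sheafify_isSheaf
  smul {i j k} h U := AddMonoidHom.mk' (fun a =>
    { toFun := fun (s : P.sheafSec j U) => (⟨fun x => P.stalkSmul h a x.2 (s.1 x), fun x => by
        obtain ⟨V, hxV, hV, p, hp⟩ := s.2 x
        refine ⟨V, hxV, hV, P.smul h (O.res hV a) p, fun y hy => ?_⟩
        change P.stalkSmul h a _ (s.1 ⟨y, hV hy⟩) = _
        rw [hp y hy, P.stalkSmul_germ h a _ hV]⟩ : P.sheafSec k U)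
      map_zero' := Subtype.ext (funext fun x => map_zero _)
      map_add' := fun s t => Subtype.ext (funext fun x => map_add _ _ _) }) fun a b => by
    ext s : 1
    refine Subtype.ext (funext fun x => ?_)
    change P.stalkSmul h (a + b) x.2 (s.1 x)
      = P.stalkSmul h a x.2 (s.1 x) + P.stalkSmul h b x.2 (s.1 x)
    obtain ⟨V, hV, hxV, p, hp⟩ := P.exists_germ_le x.2 (s.1 x)
    rw [← hp, P.stalkSmul_germ h _ _ hV, P.stalkSmul_germ h _ _ hV, P.stalkSmul_germ h _ _ hV]
    simp
  one_smul {k U} s := by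
    refine Subtype.ext (funext fun x => ?_)
    change P.stalkSmul _ (O.one U) x.2 (s.1 x) = s.1 x
    obtain ⟨V, hV, hxV, p, hp⟩ := P.exists_germ_le x.2 (s.1 x)
    rw [← hp, P.stalkSmul_germ _ _ _ hV, O.res_one, P.one_smul]
  mul_smul {i j k ij jk l} h₁ h₂ h₃ h₄ U a b s := by
    refine Subtype.ext (funext fun x => ?_)
    change P.stalkSmul h₂ (O.mul h₁ a b) x.2 (s.1 x)
      = P.stalkSmul h₄ a x.2 (P.stalkSmul h₃ b x.2 (s.1 x))
    obtain ⟨V, hV, hxV, p, hp⟩ := P.exists_germ_le x.2 (s.1 x)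
    rw [← hp, P.stalkSmul_germ _ _ _ hV, P.stalkSmul_germ _ _ _ hV, P.stalkSmul_germ _ _ _ hV,
      O.res_mul, P.mul_smul h₁ h₂ h₃ h₄]
  res_smul {i j k} h U V hV a s := by
    refine Subtype.ext (funext fun x => ?_)
    change P.stalkSmul h a (hV x.2) (s.1 ⟨x.1, hV x.2⟩)
      = P.stalkSmul h (O.res hV a) x.2 (s.1 ⟨x.1, hV x.2⟩)
    obtain ⟨W, hW, hxW, p, hp⟩ := P.exists_germ_le x.2 (s.1 ⟨x.1, hV x.2⟩)
    rw [← hp, P.stalkSmul_germ _ _ _ (hW.trans hV), P.stalkSmul_germ _ _ _ hW, O.res_res]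

end GrModPresheaf

end Sheafify

/-- Extension of scalars of a sheaf of graded modules along `φ : O → O'`: the sheaf associated to
the tensor product of `O'` and `F` over `O`. This is the module of sections of the pullback of a
vector bundle along the morphism of graded manifolds with underlying map the identity of `X` and
pullback of functions `φ`. -/
def GrModSheaf.pullback {X : Type u} [TopologicalSpace X] {O O' : GrRingSheaf X} (φ : O.Hom O')
    (F : GrModSheaf O) : GrModSheaf O' :=
  GrModPresheaf.sheafify (tensorPresheaf φ F)

/-! ## Nonnegatively graded manifolds and their vector bundles -/

section NManifold

variable (n : ℕ) (M : Type u) [TopologicalSpace M] [ChartedSpace (EuclideanSpace ℝ (Fin n)) M]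

/-- Smooth real functions on an open subset of `M`. -/
abbrev SmoothFun (U : Opens M) : Type u := C^∞⟮𝓡 n, U; 𝓘(ℝ, ℝ), ℝ⟯

/-- Restriction of smooth functions. -/
abbrev SmoothFun.res {n : ℕ} {M : Type u} [TopologicalSpace M]
    [ChartedSpace (EuclideanSpace ℝ (Fin n)) M] {U V : Opens M} (h : V ≤ U) :
    SmoothFun n M U →+* SmoothFun n M V :=
  ContMDiffMap.restrictRingHom (𝓡 n) 𝓘(ℝ, ℝ) ℝ h

/-- Smooth functions, of degree `0`, as a graded object: the other degrees are zero. -/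
def smoothSec (k : ℤ) (U : Opens M) : AddSubgroup (SmoothFun n M U) where
  carrier := {f | k ≠ 0 → f = 0}
  zero_mem' _ := rfl
  add_mem' hf hg hk := by rw [hf hk, hg hk, add_zero]
  neg_mem' hf hk := by rw [hf hk, neg_zero]

/-- The graded presheaf of smooth functions on `M`, concentrated in degree `0`. -/
def smoothPresheaf : GrPresheaf M where
  sec k U := smoothSec n M k U
  res {k U V} h :=
    { toFun := fun f => ⟨SmoothFun.res h f.1, fun hk => by rw [f.2 hk, map_zero]⟩
      map_zero' := Subtype.ext (map_zero _)
      map_add' := fun _ _ => Subtype.ext (map_add _ _ _) }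
  res_self _ := rfl
  res_res _ _ _ := rfl

lemma smoothPresheaf_isSheaf : (smoothPresheaf n M).IsSheaf := by
  intro k ι U s hs
  have hs' : ∀ a b (y : M) (ha : y ∈ U a) (hb : y ∈ U b),
      (s a).1 ⟨y, ha⟩ = (s b).1 ⟨y, hb⟩ := fun a b y ha hb =>
    DFunLike.congr_fun (congrArg Subtype.val (hs a b)) (⟨y, ha, hb⟩ : (U a ⊓ U b : Opens M))
  have hx : ∀ x : (⨆ a, U a : Opens M), ∃ a, x.1 ∈ U a := fun x => Opens.mem_iSup.1 x.2
  choose a ha using hx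
  let f : (⨆ a, U a : Opens M) → ℝ := fun x => (s (a x)).1 ⟨x.1, ha x⟩
  have hf : ContMDiff (𝓡 n) 𝓘(ℝ, ℝ) ∞ f := by
    intro x
    have h := (s (a x)).1.contMDiff ⟨x.1, ha x⟩
    have e : (s (a x)).1 = f ∘ Set.inclusion (le_iSup U (a x)) := by
      funext y
      exact hs' _ _ _ _ _
    rw [e] at h
    exact ((contDiffWithinAt_localInvariantProp ∞).liftPropAt_iff_comp_inclusion (le_iSup U (a x)) f
      ⟨x.1, ha x⟩).2 h
  refine ⟨⟨⟨f, hf⟩, fun hk => ?_⟩, fun b => ?_, fun t ht => ?_⟩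
  · ext x
    change (s (a x)).1 ⟨x.1, ha x⟩ = 0
    rw [(s (a x)).2 hk]; rfl
  · exact Subtype.ext (DFunLike.ext _ _ fun x => hs' _ _ _ _ _)
  · exact Subtype.ext (DFunLike.ext _ _ fun x =>
      DFunLike.congr_fun (congrArg Subtype.val (ht (a x))) (⟨x.1, ha x⟩ : U (a x)))

/-- The structure sheaf of the ordinary manifold `M`, as a sheaf of graded rings. -/
def smoothSheafGr : GrRingSheaf M where
  toGrPresheaf := smoothPresheaf n M
  isSheaf := smoothPresheaf_isSheaf n M
  one U := ⟨1, fun h => absurd rfl h⟩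
  mul {i j k} h U := AddMonoidHom.mk' (fun (f : smoothSec n M i U) =>
    { toFun := fun (g : smoothSec n M j U) => (⟨f.1 * g.1, fun hk => by
        by_cases hi : i = 0
        · rw [g.2 (by omega), mul_zero]
        · rw [f.2 hi, zero_mul]⟩ : smoothSec n M k U)
      map_zero' := Subtype.ext (mul_zero _)
      map_add' := fun _ _ => Subtype.ext (mul_add _ _ _) }) fun f g => by
    ext t : 1
    exact Subtype.ext (add_mul _ _ _)
  one_mul a := Subtype.ext (one_mul a.1)
  mul_one a := Subtype.ext (mul_one a.1)
  mul_assoc _ _ _ _ _ a b c := Subtype.ext (mul_assoc a.1 b.1 c.1)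
  res_one _ := rfl
  res_mul _ _ _ _ _ _ := rfl

variable {n M}

/-- The product `ξ j₁ * (ξ j₂ * ⋯)` along a list of indices. -/
def GrRingSheaf.monomial (O : GrRingSheaf M) {U : Opens M} {J : Type} (d : J → ℤ)
    (ξ : ∀ j, O.sec (d j) U) : (l : List J) → O.sec (l.map d).sum U
  | [] => O.one U
  | j :: l => O.mul (by simp) (ξ j) (O.monomial d ξ l)

/-- Standard monomials in coordinates of degrees `d`: the factors are in increasing order, and a
coordinate of odd degree occurs at most once. -/
def IsStdMonomial {J : Type} [LinearOrder J] (d : J → ℤ) (l : List J) : Prop :=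
  l.Pairwise fun a b => a < b ∨ (a = b ∧ Even (d a))

/-- An `N`-manifold (nonnegatively graded manifold) with body `M`: a sheaf of graded-commutative
graded rings on `M` whose degree `0` part is the sheaf of smooth functions of `M`, and which near
every point is freely generated over smooth functions by graded-commuting coordinates of positive
degrees, finitely many in each degree. -/
structure NManifold (n : ℕ) (M : Type u) [TopologicalSpace M]
    [ChartedSpace (EuclideanSpace ℝ (Fin n)) M] extends GrRingSheaf M where
  /-- Identification of smooth functions on `U ⊆ M` with functions of degree `0`. -/
  fn : ∀ U : Opens M, SmoothFun n M U ≃+ sec 0 U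
  fn_one : ∀ U, fn U 1 = one U
  fn_mul : ∀ (U : Opens M) (f g : SmoothFun n M U),
    fn U (f * g) = mul (zero_add 0) (fn U f) (fn U g)
  fn_res : ∀ {U V : Opens M} (h : V ≤ U) (f : SmoothFun n M U),
    fn V (SmoothFun.res h f) = res h (fn U f)
  comm : ∀ {i j k : ℤ} (h : i + j = k) (h' : j + i = k) {U : Opens M} (a : sec i U)
    (b : sec j U), mul h a b = (i * j).negOnePow • mul h' b a
  nonneg : ∀ k < 0, ∀ (U : Opens M) (a : sec k U), a = 0
  coords : ∀ x : M, ∃ (U : Opens M) (_ : x ∈ U) (J : Type) (_ : LinearOrder J) (d : J → ℤ)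
    (ξ : ∀ j, sec (d j) U), (∀ j, 0 < d j) ∧ (∀ k, {j | d j = k}.Finite) ∧
    ∀ (V : Opens M) (hV : V ≤ U) (k : ℤ) (a : sec k V),
      ∃! c : {l : List J // IsStdMonomial d l ∧ (l.map d).sum = k} →₀ SmoothFun n M V,
        a = c.sum fun l f => mul ((zero_add _).trans l.2.2) (fn V f)
          (res hV (toGrRingSheaf.monomial d ξ l.1))

namespace NManifold

variable (𝓜 : NManifold n M)

/-- The embedding of smooth functions on the body. -/
def projAux (k : ℤ) (U : Opens M) : SmoothFun n M U →+ 𝓜.sec k U :=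
  if h : k = 0 then by subst h; exact (𝓜.fn U).toAddMonoidHom else 0

lemma projAux_zero (U : Opens M) (f : SmoothFun n M U) : 𝓜.projAux 0 U f = 𝓜.fn U f := rfl

lemma projAux_ne {k : ℤ} (hk : k ≠ 0) (U : Opens M) : 𝓜.projAux k U = 0 := dif_neg hk

/-- The degree `0` part of a function. -/
def zeroAux (k : ℤ) (U : Opens M) : 𝓜.sec k U →+ SmoothFun n M U :=
  if h : k = 0 then by subst h; exact (𝓜.fn U).symm.toAddMonoidHom else 0

lemma zeroAux_zero (U : Opens M) (a : 𝓜.sec 0 U) : 𝓜.zeroAux 0 U a = (𝓜.fn U).symm a := rfl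

lemma zeroAux_ne {k : ℤ} (hk : k ≠ 0) (U : Opens M) : 𝓜.zeroAux k U = 0 := dif_neg hk

/-- Pullback of functions along the projection `π : 𝓜 → M`: smooth functions on `M` are the
functions of degree `0` on `𝓜`. -/
def proj : (smoothSheafGr n M).Hom 𝓜.toGrRingSheaf where
  toFun {k U} := (𝓜.projAux k U).comp (smoothSec n M k U).subtype
  map_one U := 𝓜.fn_one U
  map_mul {i j k} h U a b := by
    change 𝓜.projAux k U (a.1 * b.1) = 𝓜.mul h (𝓜.projAux i U a.1) (𝓜.projAux j U b.1)
    by_cases hi : i = 0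
    · by_cases hj : j = 0
      · obtain rfl : k = 0 := by omega
        subst hi hj
        exact 𝓜.fn_mul U _ _
      · rw [b.2 hj, mul_zero, map_zero, map_zero, map_zero]
    · rw [a.2 hi, zero_mul, map_zero, map_zero, map_zero, AddMonoidHom.zero_apply]
  map_res {k U V} h a := by
    change 𝓜.projAux k V (SmoothFun.res h a.1) = 𝓜.res h (𝓜.projAux k U a.1)
    by_cases hk : k = 0
    · subst hk
      exact 𝓜.fn_res h _
    · rw [a.2 hk, map_zero, map_zero, map_zero, map_zero]

/-- Pullback of functions along the zero embedding `0 : M → 𝓜`: it annihilates functions of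
positive degree, and is the identification with smooth functions in degree `0`. -/
def zeroEmb : 𝓜.toGrRingSheaf.Hom (smoothSheafGr n M) where
  toFun {k U} := (𝓜.zeroAux k U).codRestrict (smoothSec n M k U)
    (fun a hk => by rw [zeroAux_ne 𝓜 hk]; rfl)
  map_one U := Subtype.ext (by
    change (𝓜.fn U).symm (𝓜.one U) = 1
    rw [← 𝓜.fn_one, AddEquiv.symm_apply_apply])
  map_mul {i j k} h U a b := Subtype.ext (by
    change 𝓜.zeroAux k U (𝓜.mul h a b) = 𝓜.zeroAux i U a * 𝓜.zeroAux j U b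
    rcases lt_trichotomy i 0 with hi | hi | hi
    · rw [𝓜.nonneg i hi U a, map_zero, map_zero, AddMonoidHom.zero_apply, map_zero, zero_mul]
    · by_cases hj : j = 0
      · obtain rfl : k = 0 := by omega
        subst hi hj
        rw [zeroAux_zero, zeroAux_zero, zeroAux_zero, AddEquiv.symm_apply_eq, 𝓜.fn_mul,
          AddEquiv.apply_symm_apply, AddEquiv.apply_symm_apply]
      · rw [zeroAux_ne 𝓜 hj, zeroAux_ne 𝓜 (show k ≠ 0 by omega)]
        simp
    · rw [zeroAux_ne 𝓜 hi.ne']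
      by_cases hk : k = 0
      · rw [𝓜.nonneg j (by omega) U b, map_zero, map_zero, map_zero, mul_zero]
      · rw [zeroAux_ne 𝓜 hk]
        simp)
  map_res {k U V} h a := Subtype.ext (by
    change 𝓜.zeroAux k V (𝓜.res h a) = SmoothFun.res h (𝓜.zeroAux k U a)
    by_cases hk : k = 0
    · subst hk
      rw [zeroAux_zero, zeroAux_zero, AddEquiv.symm_apply_eq, 𝓜.fn_res,
        AddEquiv.apply_symm_apply]
    · rw [zeroAux_ne 𝓜 hk, zeroAux_ne 𝓜 hk]
      simp)

/-- A vector bundle over `𝓜`, given by its sheaf of sections: a locally free sheaf of graded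
modules over the functions of `𝓜`. The rank in degree `i` near `x` is `rank x i`. -/
structure VectorBundle (𝓜 : NManifold n M) extends GrModSheaf 𝓜.toGrRingSheaf where
  rank : M → ℤ → ℕ
  locallyFree : toGrModSheaf.IsLocallyFree rank

/-- The ranks vanish in degrees `< a` and in degrees `> b`, for some integers `a`, `b`. -/
def VectorBundle.DegreeBounded {𝓜 : NManifold n M} (B : 𝓜.VectorBundle) : Prop :=
  ∃ a b : ℤ, ∀ (x : M) (i : ℤ), (i < a → B.rank x i = 0) ∧ (b < i → B.rank x i = 0)

/-- The ranks are bounded in degree on (at least) one side. -/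
def VectorBundle.Semibounded {𝓜 : NManifold n M} (B : 𝓜.VectorBundle) : Prop :=
  (∃ a : ℤ, ∀ (x : M), ∀ i < a, B.rank x i = 0) ∨ (∃ b : ℤ, ∀ (x : M), ∀ i > b, B.rank x i = 0)

/-- The standard graded vector bundle `0^* B` over `M` associated to `B`. -/
def VectorBundle.standard {𝓜 : NManifold n M} (B : 𝓜.VectorBundle) :
    GrModSheaf (smoothSheafGr n M) :=
  B.toGrModSheaf.pullback 𝓜.zeroEmb

end NManifold

end NManifold

end

/-! Call a splitting of `B` a decomposition of `B` into summands `O ⊗ H m`, with `H m` of degree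
`m`, recorded by its projections `P m` on stalks (`IsSplittingAt`). A frame gives a splitting
locally. A global splitting gives the isomorphism: on `π^* 0^* B` the map `psi`, `a ⊗ (f ⊗ b) ↦ a f
P k b` for `b` of degree `k`, is well defined because `P k` kills multiples of elements of degree
below `k`.

Splittings are glued by deformation. All splittings have the same filtration by degree of
generators, because `P l` kills every element generated in degrees below `l`; any two also agree on
the associated graded object (`IsSplittingAt.compatible`). Hence `P j Q m P a` vanishes unless `j ≤
m ≤ a`. Conjugating `Q m` by the formal automorphism acting as `λ ^ (-i)` on the `i`-th summand of
`P` gives `∑ λ ^ (a - j) P j Q m P a`, which involves no negative powers. It therefore makes sense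
for every smooth function `λ`, equals `P m` where `λ = 0` and `Q m` where `λ = 1`, and is again a
splitting (`isResolution_twist`, `IsSplittingAt.deform`). Taking bump functions for `λ`, one at a
time along a locally finite countable cover, extends a splitting to all of `M`
(`exists_isRegularSplittingAt`).

Everything takes place on stalks. Infinite families of projections cause no trouble, since only
finitely many act nontrivially on a germ and the same finite set serves for a section near the point
(`isRegularAt_sumHom`). The map `psi` is onto because the image of `P m` is generated in degree `m`,
and it is injective because with respect to a frame it is unitriangular (`proj_psi_tensorFrameSum`).
-/

noncomputable section

/-! ## Germs and sections -/

section Germs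

open Topology Filter

variable {X : Type u} [TopologicalSpace X]

namespace GrPresheaf

variable (P : GrPresheaf X)

lemma exists_res_eq_zero {k : ℤ} {x : X} {U : Opens X} (hx : x ∈ U) (p : P.sec k U)
    (h : P.germ hx p = 0) : ∃ (V : Opens X) (hV : V ≤ U), x ∈ V ∧ P.res hV p = 0 := by
  classical
  let f : ∀ U V : Nbhd x, U ≤ V → P.sec k U.ofDual.1 →+ P.sec k V.ofDual.1 :=
    fun _ _ h => P.res (k := k) h
  have : DirectedSystem (fun U : Nbhd x => P.sec k U.ofDual.1) (fun U V h => f U V h) :=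
    ⟨fun _ a => P.res_self a, fun _ _ _ h h' a => P.res_res h h' a⟩
  obtain ⟨V, hV, h⟩ := AddCommGroup.DirectLimit.of.zero_exact
    (G := fun U : Nbhd x => P.sec k U.ofDual.1) (f := f) (OrderDual.toDual ⟨U, hx⟩) p h
  exact ⟨V.ofDual.1, hV, V.ofDual.2, h⟩

lemma exists_res_eq_res {k : ℤ} {x : X} {U V : Opens X} (hU : x ∈ U) (hV : x ∈ V)
    (p : P.sec k U) (q : P.sec k V) (h : P.germ hU p = P.germ hV q) :
    ∃ (W : Opens X) (hWU : W ≤ U) (hWV : W ≤ V), x ∈ W ∧ P.res hWU p = P.res hWV q := by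
  have hUV : x ∈ U ⊓ V := ⟨hU, hV⟩
  obtain ⟨W, hW, hxW, h⟩ := P.exists_res_eq_zero hUV
    (P.res inf_le_left p - P.res inf_le_right q) (by
      rw [map_sub, P.germ_res, P.germ_res, h, sub_self])
  refine ⟨W, hW.trans inf_le_left, hW.trans inf_le_right, hxW, ?_⟩
  rwa [map_sub, P.res_res, P.res_res, sub_eq_zero] at h

variable {P}

/-- The sheaf axiom yields a section over `⨆ x, V x`. Restricting along the two inequalities places
it on `U` itself, without transport along an equality of open sets. -/
lemma IsSheaf.glue (hP : P.IsSheaf) {k : ℤ} {U : Opens X} (V : U → Opens X)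
    (hV : ∀ x, V x ≤ U) (hxV : ∀ x : U, x.1 ∈ V x) (s : ∀ x, P.sec k (V x))
    (hs : ∀ x y, P.res (V := V x ⊓ V y) inf_le_left (s x) = P.res inf_le_right (s y)) :
    ∃! t : P.sec k U, ∀ x, P.res (hV x) t = s x := by
  obtain ⟨t, ht, htu⟩ := hP k U V s hs
  have h₁ : U ≤ ⨆ x, V x := fun x hx => Opens.mem_iSup.2 ⟨⟨x, hx⟩, hxV ⟨x, hx⟩⟩
  have h₂ : ⨆ x, V x ≤ U := iSup_le hV
  refine ⟨P.res h₁ t, fun x => by rw [P.res_res, ht], fun t' ht' => ?_⟩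
  rw [← htu (P.res h₂ t') fun x => by rw [P.res_res, ht'], P.res_res, P.res_self]

lemma IsSheaf.eq_of_germ_eq (hP : P.IsSheaf) {k : ℤ} {U : Opens X} (s t : P.sec k U)
    (h : ∀ x (hx : x ∈ U), P.germ hx s = P.germ hx t) : s = t := by
  choose V hV hV' hxV hst using fun x : U => P.exists_res_eq_res x.2 x.2 s t (h x.1 x.2)
  refine (hP.glue V hV hxV (fun x => P.res (hV x) s) fun x y => ?_).unique
    (fun _ => rfl) fun x => (hst x).symm
  rw [P.res_res, P.res_res]

lemma IsSheaf.exists_section (hP : P.IsSheaf) {k : ℤ} {U : Opens X} (s : P.sheafSec k U) :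
    ∃ t : P.sec k U, ∀ x (hx : x ∈ U), P.germ hx t = s.1 ⟨x, hx⟩ := by
  choose V hxV hV p hp using s.2
  obtain ⟨t, ht, -⟩ := hP.glue V hV hxV p fun x y => hP.eq_of_germ_eq _ _ fun z hz => by
    rw [P.germ_res, P.germ_res, ← hp x z hz.1, ← hp y z hz.2]
  refine ⟨t, fun x hx => ?_⟩
  rw [hp ⟨x, hx⟩ x (hxV ⟨x, hx⟩), ← ht ⟨x, hx⟩, P.germ_res]

/-! ### Families of germs, and maps of stalks, that come locally from sections. -/

variable (P)

/-- The family of germs `φ` is given by a section in a neighbourhood of `x`. -/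
def IsSectionAt {k : ℤ} (φ : ∀ y, P.Stalk k y) (x : X) : Prop :=
  ∃ (U : Opens X) (_ : x ∈ U) (t : P.sec k U), ∀ y (hy : y ∈ U), φ y = P.germ hy t

open Classical in
/-- The family of germs of a section, extended by zero. -/
def germs {k : ℤ} {U : Opens X} (s : P.sec k U) (y : X) : P.Stalk k y :=
  if hy : y ∈ U then P.germ hy s else 0

variable {P}

lemma germs_apply {k : ℤ} {U : Opens X} (s : P.sec k U) {y : X} (hy : y ∈ U) :
    P.germs s y = P.germ hy s := dif_pos hy

lemma isSectionAt_germs {k : ℤ} {U : Opens X} (s : P.sec k U) {x : X} (hx : x ∈ U) :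
    P.IsSectionAt (P.germs s) x :=
  ⟨U, hx, s, fun _ hy => germs_apply s hy⟩

namespace IsSectionAt

variable {k : ℤ} {φ ψ : ∀ y, P.Stalk k y} {x : X}

lemma zero : P.IsSectionAt (fun y => (0 : P.Stalk k y)) x :=
  ⟨⊤, trivial, 0, fun y hy => by rw [map_zero]⟩

lemma add (hφ : P.IsSectionAt φ x) (hψ : P.IsSectionAt ψ x) :
    P.IsSectionAt (fun y => φ y + ψ y) x := by
  obtain ⟨U, hU, s, hs⟩ := hφ
  obtain ⟨V, hV, t, ht⟩ := hψ
  refine ⟨U ⊓ V, ⟨hU, hV⟩, P.res inf_le_left s + P.res inf_le_right t, fun y hy => ?_⟩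
  simp only [map_add, P.germ_res, hs y hy.1, ht y hy.2]

lemma neg (hφ : P.IsSectionAt φ x) : P.IsSectionAt (fun y => - φ y) x := by
  obtain ⟨U, hU, s, hs⟩ := hφ
  exact ⟨U, hU, -s, fun y hy => by simp only [map_neg, hs y hy]⟩

lemma sum {ι : Type*} (T : Finset ι) {φ : ι → ∀ y, P.Stalk k y}
    (h : ∀ i ∈ T, P.IsSectionAt (φ i) x) : P.IsSectionAt (fun y => ∑ i ∈ T, φ i y) x := by
  classical
  induction T using Finset.induction_on with
  | empty => simpa using zero
  | insert i T hi ih =>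
    simp only [Finset.sum_insert hi]
    exact (h i (Finset.mem_insert_self i T)).add
      (ih fun j hj => h j (Finset.mem_insert_of_mem hj))

lemma congr (hφ : P.IsSectionAt φ x) (h : ∀ᶠ y in 𝓝 x, φ y = ψ y) : P.IsSectionAt ψ x := by
  obtain ⟨U, hU, s, hs⟩ := hφ
  obtain ⟨V, hV, hVo, hxV⟩ := eventually_nhds_iff.1 h
  refine ⟨U ⊓ ⟨V, hVo⟩, ⟨hU, hxV⟩, P.res inf_le_left s, fun y hy => ?_⟩
  rw [P.germ_res, ← hs y hy.1, hV y hy.2]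

/-- An identity between sections spreads from one stalk to nearby stalks; finite expansions found at
a point thereby remain valid around it. -/
lemma eventually_eq (hφ : P.IsSectionAt φ x) (hψ : P.IsSectionAt ψ x) (h : φ x = ψ x) :
    ∀ᶠ y in 𝓝 x, φ y = ψ y := by
  obtain ⟨U, hU, s, hs⟩ := hφ
  obtain ⟨V, hV, t, ht⟩ := hψ
  rw [hs x hU, ht x hV] at h
  obtain ⟨W, hWU, hWV, hxW, hW⟩ := P.exists_res_eq_res hU hV s t h
  filter_upwards [W.isOpen.mem_nhds hxW] with y hy
  rw [hs y (hWU hy), ht y (hWV hy), ← P.germ_res hWU hy, hW, P.germ_res]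

/-- A section representing the family inside a given neighbourhood. -/
lemma exists_le (hφ : P.IsSectionAt φ x) {U : Opens X} (hx : x ∈ U) :
    ∃ (V : Opens X) (_ : V ≤ U) (_ : x ∈ V) (t : P.sec k V),
      ∀ y (hy : y ∈ V), φ y = P.germ hy t := by
  obtain ⟨V, hV, s, hs⟩ := hφ
  exact ⟨U ⊓ V, inf_le_left, ⟨hx, hV⟩, P.res inf_le_right s, fun y hy => by
    rw [P.germ_res, hs y hy.2]⟩

end IsSectionAt

/-- The family `f` of maps of stalks takes sections to sections near `x`. -/
def IsRegularAt {P Q : GrPresheaf X} {k l : ℤ} (f : ∀ y, P.Stalk k y →+ Q.Stalk l y)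
    (x : X) : Prop :=
  ∀ φ : ∀ y, P.Stalk k y, P.IsSectionAt φ x → Q.IsSectionAt (fun y => f y (φ y)) x

lemma IsRegularAt.congr {P Q : GrPresheaf X} {k l : ℤ} {f g : ∀ y, P.Stalk k y →+ Q.Stalk l y}
    {x : X} (hf : IsRegularAt f x) (h : ∀ᶠ y in 𝓝 x, f y = g y) : IsRegularAt g x :=
  fun φ hφ => (hf φ hφ).congr (h.mono fun y hy => by rw [hy])

lemma isRegularAt_of_germs {P Q : GrPresheaf X} {k l : ℤ}
    {f : ∀ y, P.Stalk k y →+ Q.Stalk l y} {x : X}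
    (h : ∀ (U : Opens X) (s : P.sec k U), x ∈ U → Q.IsSectionAt (fun y => f y (P.germs s y)) x) :
    IsRegularAt f x := by
  rintro φ ⟨U, hU, s, hs⟩
  refine (h U s hU).congr ?_
  filter_upwards [U.isOpen.mem_nhds hU] with y hy
  rw [hs y hy, germs_apply s hy]

end GrPresheaf

/-! ### The action of functions on stalks. -/

namespace GrModPresheaf

variable {O : GrRingSheaf X} (P : GrModPresheaf O)

lemma stalkSmul_one {k : ℤ} {U : Opens X} {x : X} (hx : x ∈ U) (z : P.Stalk k x) :
    P.stalkSmul (zero_add k) (O.one U) hx z = z := by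
  obtain ⟨V, hV, hxV, p, rfl⟩ := P.exists_germ_le hx z
  rw [P.stalkSmul_germ _ _ _ hV, O.res_one, P.one_smul]

lemma stalkSmul_mul {i j k ij jk l : ℤ} (h₁ : i + j = ij) (h₂ : ij + k = l) (h₃ : j + k = jk)
    (h₄ : i + jk = l) {U : Opens X} (a : O.sec i U) (b : O.sec j U) {x : X} (hx : x ∈ U)
    (z : P.Stalk k x) : P.stalkSmul h₂ (O.mul h₁ a b) hx z
      = P.stalkSmul h₄ a hx (P.stalkSmul h₃ b hx z) := by
  obtain ⟨V, hV, hxV, p, rfl⟩ := P.exists_germ_le hx z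
  rw [P.stalkSmul_germ _ _ _ hV, P.stalkSmul_germ _ _ _ hV, P.stalkSmul_germ _ _ _ hV,
    O.res_mul, P.mul_smul h₁ h₂ h₃ h₄]

lemma stalkSmul_add {i j k : ℤ} (h : i + j = k) {U : Opens X} (a b : O.sec i U) {x : X}
    (hx : x ∈ U) (z : P.Stalk j x) :
    P.stalkSmul h (a + b) hx z = P.stalkSmul h a hx z + P.stalkSmul h b hx z := by
  obtain ⟨V, hV, hxV, p, rfl⟩ := P.exists_germ_le hx z
  rw [P.stalkSmul_germ _ _ _ hV, P.stalkSmul_germ _ _ _ hV, P.stalkSmul_germ _ _ _ hV,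
    map_add, map_add, AddMonoidHom.add_apply, map_add]

lemma stalkSmul_zero {i j k : ℤ} (h : i + j = k) {U : Opens X} {x : X}
    (hx : x ∈ U) (z : P.Stalk j x) : P.stalkSmul h (0 : O.sec i U) hx z = 0 := by
  have := P.stalkSmul_add h (0 : O.sec i U) 0 hx z
  rwa [add_zero, left_eq_add] at this

lemma stalkSmul_res {i j k : ℤ} (h : i + j = k) {U V : Opens X} (hV : V ≤ U) (a : O.sec i U)
    {x : X} (hx : x ∈ V) (z : P.Stalk j x) :
    P.stalkSmul h (O.res hV a) hx z = P.stalkSmul h a (hV hx) z := by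
  obtain ⟨W, hW, hxW, p, rfl⟩ := P.exists_germ_le hx z
  rw [P.stalkSmul_germ _ _ _ hW, P.stalkSmul_germ _ _ _ (hW.trans hV), O.res_res]

lemma germ_smul {i j k : ℤ} (h : i + j = k) {U : Opens X} (a : O.sec i U) (s : P.sec j U)
    {x : X} (hx : x ∈ U) :
    P.germ hx (P.smul h a s) = P.stalkSmul h a hx (P.germ hx s) := by
  rw [P.stalkSmul_germ h a hx le_rfl hx, O.res_self]

end GrModPresheaf

/-- A family of bijections of stalks that is linear and takes sections to sections identifies a
sheaf of modules with the sheaf associated to a presheaf. -/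
theorem GrModSheaf.nonempty_iso_sheafify {O : GrRingSheaf X} (B : GrModSheaf O)
    (Q : GrModPresheaf O) (f : ∀ (k : ℤ) (x : X), Q.Stalk k x →+ B.Stalk k x)
    (hf : ∀ k x, Function.Bijective (f k x))
    (hlin : ∀ {i j k : ℤ} (h : i + j = k) {U : Opens X} (a : O.sec i U) {x : X} (hx : x ∈ U)
      (z : Q.Stalk j x), f k x (Q.stalkSmul h a hx z) = B.stalkSmul h a hx (f j x z))
    (hreg : ∀ k x, GrPresheaf.IsRegularAt (f k) x) : Nonempty (B.Iso Q.sheafify) := by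
  let g : ∀ k x, Q.Stalk k x ≃+ B.Stalk k x := fun k x => AddEquiv.ofBijective (f k x) (hf k x)
  have hg : ∀ k x z, g k x z = f k x z := fun _ _ _ => rfl
  have hg' : ∀ k x z, f k x ((g k x).symm z) = z := fun k x => (g k x).apply_symm_apply
  let F : ∀ k U, B.sec k U →+ Q.sheafSec k U := fun k U =>
    { toFun := fun s => ⟨fun x => (g k x.1).symm (B.germ x.2 s), fun x => by
        -- A section `q` representing the preimage of the germ of `s` at one point represents it
        -- nearby too: the image of `q` and `s` agree at that point, hence around it.
        obtain ⟨V, hV, hxV, q, hq⟩ := Q.exists_germ_le x.2 ((g k x.1).symm (B.germ x.2 s))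
        obtain ⟨W, hxW, hW⟩ := eventually_nhds_iff.1 <|
          ((hreg k x.1 _ (GrPresheaf.isSectionAt_germs q hxV)).eventually_eq
            (GrPresheaf.isSectionAt_germs s x.2) (by
              rw [GrPresheaf.germs_apply q hxV, GrPresheaf.germs_apply s x.2, hq]
              exact hg' _ _ _))
        refine ⟨V ⊓ ⟨W, hW.1⟩, ⟨hxV, hW.2⟩, inf_le_left.trans hV, Q.res inf_le_left q,
          fun y hy => ?_⟩
        have := hxW y hy.2
        rw [GrPresheaf.germs_apply q hy.1, GrPresheaf.germs_apply s (hV hy.1)] at this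
        rw [Q.germ_res, AddEquiv.symm_apply_eq, hg, this]⟩
      map_zero' := Subtype.ext (funext fun x => by simp)
      map_add' := fun s t => Subtype.ext (funext fun x => by simp) }
  have hF : ∀ k U, Function.Bijective (F k U) := fun k U => by
    constructor
    · intro s t hst
      refine B.isSheaf.eq_of_germ_eq s t fun x hx => ?_
      exact (g k x).symm.injective (congrFun (congrArg Subtype.val hst) ⟨x, hx⟩)
    · intro τ
      -- The images under `f` of the germs of `τ` are locally given by sections, so they glue
      -- because `B` is a sheaf.
      obtain ⟨t, ht⟩ := B.isSheaf.exists_section (⟨fun x => f k x.1 (τ.1 x), fun x => by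
        obtain ⟨V, hxV, hV, q, hq⟩ := τ.2 x
        obtain ⟨W, hW, hxW, t, ht⟩ :=
          (hreg k x.1 _ (GrPresheaf.isSectionAt_germs q hxV)).exists_le hxV
        refine ⟨W, hxW, hW.trans hV, t, fun y hy => ?_⟩
        rw [← ht y hy, GrPresheaf.germs_apply q (hW hy), ← hq y (hW hy)]⟩ : B.sheafSec k U)
      refine ⟨t, Subtype.ext (funext fun x => ?_)⟩
      change (g k x.1).symm (B.germ x.2 t) = τ.1 x
      rw [ht, AddEquiv.symm_apply_eq]
      rfl
  refine ⟨⟨fun k U => AddEquiv.ofBijective (F k U) (hF k U), fun {i j k} h U a s => ?_,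
    fun _ s => ?_⟩⟩
  · refine Subtype.ext (funext fun x => ?_)
    change (g k x.1).symm (B.germ x.2 (B.smul h a s))
      = Q.stalkSmul h a x.2 ((g j x.1).symm (B.germ x.2 s))
    rw [AddEquiv.symm_apply_eq, hg, hlin, hg', B.germ_smul]
  · refine Subtype.ext (funext fun x => ?_)
    exact congrArg (g _ x.1).symm (B.germ_res _ _ _)

end Germs

/-! ## Resolutions of the identity -/

section Resolution

variable {S S' : Type u} [AddCommGroup S] [AddCommGroup S']

/-- Orthogonal idempotents `p i`, almost all of which vanish on any given element, with sum `1`. -/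
structure IsResolution (p : ℤ → S →+ S) : Prop where
  idem : ∀ i z, p i (p i z) = p i z
  orth : ∀ i j z, i ≠ j → p i (p j z) = 0
  exists_sum : ∀ z, ∃ T : Finset ℤ, ∑ i ∈ T, p i z = z

namespace IsResolution

variable {p : ℤ → S →+ S} {p' : ℤ → S' →+ S'}

lemma eq_zero_of_sum (hp : IsResolution p) {T : Finset ℤ} {z : S} (h : ∑ i ∈ T, p i z = z)
    {l : ℤ} (hl : l ∉ T) : p l z = 0 := by
  rw [← h, map_sum]
  exact Finset.sum_eq_zero fun i hi => hp.orth l i z fun e => hl (e ▸ hi)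

lemma finite (hp : IsResolution p) (z : S) : {i | p i z ≠ 0}.Finite := by
  obtain ⟨T, hT⟩ := hp.exists_sum z
  refine T.finite_toSet.subset fun i hi => ?_
  by_contra h
  exact hi (hp.eq_zero_of_sum hT h)

lemma sum_mono (hp : IsResolution p) {T T' : Finset ℤ} {z : S} (h : ∑ i ∈ T, p i z = z)
    (hT : T ⊆ T') : ∑ i ∈ T', p i z = z := by
  rw [← Finset.sum_subset hT fun i _ hi => hp.eq_zero_of_sum h hi, h]

open Classical in
/-- The homomorphism with `p i z ↦ φ i (p i z)`. -/
def sumHom (p : ℤ → S →+ S) (φ : ℤ → S →+ S') : S →+ S' :=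
  -- The value `0` for other families keeps proofs out of the arguments, so that `twist` and
  -- `deform` are defined at every point, including those where the given family is not a splitting.
  if hp : IsResolution p then
    { toFun := fun z => ∑ᶠ i, φ i (p i z)
      map_zero' := by simp
      map_add' := fun z w => by
        simp only [map_add]
        refine finsum_add_distrib ((hp.finite z).subset fun i hi => ?_)
          ((hp.finite w).subset fun i hi => ?_) <;>
        · intro h
          exact hi (by simp only [h, map_zero]) }
  else 0

lemma sumHom_apply (hp : IsResolution p) (φ : ℤ → S →+ S') {T : Finset ℤ} {z : S}
    (h : ∑ i ∈ T, p i z = z) : sumHom p φ z = ∑ i ∈ T, φ i (p i z) := by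
  rw [sumHom, dif_pos hp]
  refine finsum_eq_sum_of_support_subset _ fun i hi => ?_
  by_contra hiT
  exact hi (by simp only [hp.eq_zero_of_sum h hiT, map_zero])

lemma sumHom_proj (hp : IsResolution p) (φ : ℤ → S →+ S') (i : ℤ) (z : S) :
    sumHom p φ (p i z) = φ i (p i z) := by
  rw [hp.sumHom_apply φ (T := {i}) (by rw [Finset.sum_singleton, hp.idem]),
    Finset.sum_singleton, hp.idem]

lemma hom_ext (hp : IsResolution p) {f g : S →+ S'} (h : ∀ i z, f (p i z) = g (p i z)) :
    f = g := by
  ext z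
  obtain ⟨T, hT⟩ := hp.exists_sum z
  rw [← hT, map_sum, map_sum]
  exact Finset.sum_congr rfl fun i _ => h i z

lemma eq_of_proj_eq (hp : IsResolution p) {z w : S} (h : ∀ i, p i z = p i w) : z = w := by
  classical
  obtain ⟨T, hT⟩ := hp.exists_sum z
  obtain ⟨T', hT'⟩ := hp.exists_sum w
  rw [← hp.sum_mono hT (Finset.subset_union_left (s₂ := T')),
    ← hp.sum_mono hT' (Finset.subset_union_right (s₁ := T))]
  exact Finset.sum_congr rfl fun i _ => h i

lemma sumHom_mem (hp : IsResolution p) (φ : ℤ → S →+ S') {F : AddSubgroup S'} {z : S}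
    (h : ∀ i, φ i (p i z) ∈ F) : sumHom p φ z ∈ F := by
  obtain ⟨T, hT⟩ := hp.exists_sum z
  rw [hp.sumHom_apply φ hT]
  exact F.sum_mem fun i _ => h i

/-- Naturality of `sumHom`. -/
lemma map_sumHom {S'' S''' : Type u} [AddCommGroup S''] [AddCommGroup S''']
    {p'' : ℤ → S'' →+ S''} (hp : IsResolution p) (hp'' : IsResolution p'')
    (φ : ℤ → S →+ S') (φ'' : ℤ → S'' →+ S''') (A : S →+ S'') (A' : S' →+ S''')
    (hA : ∀ i z, A (p i z) = p'' i (A z)) (hφ : ∀ i z, A' (φ i z) = φ'' i (A z)) (z : S) :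
    A' (sumHom p φ z) = sumHom p'' φ'' (A z) := by
  obtain ⟨T, hT⟩ := hp.exists_sum z
  rw [hp.sumHom_apply φ hT, hp''.sumHom_apply φ'' (T := T) (z := A z), map_sum]
  · exact Finset.sum_congr rfl fun i _ => by rw [hφ, hA]
  · rw [← Finset.sum_congr rfl fun i _ => hA i z, ← map_sum, hT]

/-- Two resolutions defining the same filtration and the same associated graded object. -/
structure Compatible (p q : ℤ → S →+ S) : Prop where
  left : ∀ i j z, j < i → p i (q j z) = 0
  right : ∀ i j z, j < i → q i (p j z) = 0

/-- Expand `p m z` as `∑ q l (p m z)`: the terms with `l > m` vanish, and `p m` kills those with `l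
< m`. This is the statement that `q m` is the identity on the `m`-th graded piece. -/
lemma Compatible.proj_proj_proj {p q : ℤ → S →+ S} (h : Compatible p q)
    (hp : IsResolution p) (hq : IsResolution q) (m : ℤ) (z : S) :
    p m (q m (p m z)) = p m z := by
  classical
  obtain ⟨T, hT⟩ := hq.exists_sum (p m z)
  have hT := hq.sum_mono hT (Finset.subset_insert m T)
  conv_rhs => rw [← hp.idem, ← hT, map_sum]
  rw [Finset.sum_eq_single_of_mem m (Finset.mem_insert_self m T)]
  intro l _ hl
  rcases lt_or_gt_of_ne hl with hl | hl
  · exact h.left m l _ hl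
  · rw [h.right l m _ hl, map_zero]

/-- Iterates of an endomorphism. -/
def iter (L : S →+ S) : ℕ → S →+ S
  | 0 => AddMonoidHom.id S
  | n + 1 => (iter L n).comp L

/-- The homomorphism with `p j z ↦ L ^ (a - j) (p j z)` for `j ≤ a`. -/
def scale (p : ℤ → S →+ S) (L : S →+ S) (a : ℤ) : S →+ S :=
  sumHom p fun j => iter L (a - j).toNat

/-- The conjugate of `q m` by the automorphism with `p i z ↦ L ^ (-i) (p i z)`. -/
def twist (p q : ℤ → S →+ S) (L : S →+ S) (m : ℤ) : S →+ S :=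
  sumHom p fun a => (scale p L a).comp (q m)

lemma iter_comm {A : S →+ S'} {L : S →+ S} {L' : S' →+ S'} (h : ∀ z, A (L z) = L' (A z))
    (n : ℕ) (z : S) : A (iter L n z) = iter L' n (A z) := by
  induction n generalizing z with
  | zero => rfl
  | succ n ih =>
    change A (iter L n (L z)) = iter L' n (L' (A z))
    rw [ih, h]

lemma iter_add (L : S →+ S) (n m : ℕ) (z : S) : iter L (n + m) z = iter L n (iter L m z) := by
  induction m generalizing z with
  | zero => rfl
  | succ m ih => exact ih (L z)

lemma iter_id (n : ℕ) (z : S) : iter (AddMonoidHom.id S) n z = z := by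
  induction n with
  | zero => rfl
  | succ n ih => exact ih

lemma map_scale (hp : IsResolution p) (hp' : IsResolution p') {A : S →+ S'} {L : S →+ S}
    {L' : S' →+ S'} (hA : ∀ i z, A (p i z) = p' i (A z)) (hL : ∀ z, A (L z) = L' (A z))
    (a : ℤ) (z : S) : A (scale p L a z) = scale p' L' a (A z) :=
  hp.map_sumHom hp' _ _ A A hA (fun _ z => iter_comm hL _ z) z

lemma map_twist {q : ℤ → S →+ S} {q' : ℤ → S' →+ S'} (hp : IsResolution p)
    (hp' : IsResolution p') {A : S →+ S'} {L : S →+ S}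
    {L' : S' →+ S'} (hA : ∀ i z, A (p i z) = p' i (A z)) (hL : ∀ z, A (L z) = L' (A z))
    (hq : ∀ i z, A (q i z) = q' i (A z)) (m : ℤ) (z : S) :
    A (twist p q L m z) = twist p' q' L' m (A z) :=
  hp.map_sumHom hp' _ _ A A hA (fun i z => by
    change A (scale p L i (q m z)) = scale p' L' i (q' m (A z))
    rw [map_scale hp hp' hA hL, hq]) z

lemma twist_proj {q : ℤ → S →+ S} (hp : IsResolution p) (L : S →+ S) (m a : ℤ) (z : S) :
    twist p q L m (p a z) = scale p L a (q m (p a z)) :=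
  hp.sumHom_proj _ a z

/-! ### Deforming one resolution into a compatible one. -/

section

variable {q : ℤ → S →+ S} {L : S →+ S}

lemma scale_proj (hp : IsResolution p) (a b : ℤ) (z : S) :
    scale p L a (p b z) = iter L (a - b).toNat (p b z) :=
  hp.sumHom_proj _ b z

/-- Truncation by `toNat` is harmless: components above `b` vanish, and for `c ≤ b` the exponents
satisfy `a - c = (a - b) + (b - c)`. -/
lemma scale_eq_pow_scale (hp : IsResolution p) {a b : ℤ} (hab : b ≤ a) {u : S}
    (hu : ∀ c, b < c → p c u = 0) :
    scale p L a u = iter L (a - b).toNat (scale p L b u) := by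
  obtain ⟨T, hT⟩ := hp.exists_sum u
  rw [scale, hp.sumHom_apply _ hT, scale, hp.sumHom_apply _ hT, map_sum]
  refine Finset.sum_congr rfl fun c _ => ?_
  by_cases hc : b < c
  · rw [hu c hc, map_zero, map_zero, map_zero]
  · rw [show (a - c).toNat = (a - b).toNat + (b - c).toNat by omega, iter_add]

/-- With `t` the formal automorphism `L ^ (-i)` on the `i`-th summand, `twist` is `t q t⁻¹` and
`scale p L a` is `L ^ a t`, so the first intertwines the second with `q`. The bound on `w` ensures
that only nonnegative powers of `L` occur. -/
lemma twist_scale (hp : IsResolution p) (hpq : Compatible p q)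
    (hpL : ∀ i z, p i (L z) = L (p i z)) (hqL : ∀ i z, q i (L z) = L (q i z)) (m : ℤ) {a : ℤ}
    {w : S} (hw : ∀ b, a < b → p b w = 0) :
    twist p q L m (scale p L a w) = scale p L a (q m w) := by
  obtain ⟨T, hT⟩ := hp.exists_sum w
  conv_rhs => rw [← hT, map_sum, map_sum]
  conv_lhs => rw [scale, hp.sumHom_apply _ hT, map_sum]
  refine Finset.sum_congr rfl fun b _ => ?_
  by_cases hb : a < b
  · rw [hw b hb, map_zero, map_zero, map_zero, map_zero]
  -- The power `L ^ (a - b)` passes through `twist`, which sends `p b w` to `scale p L b (q m (p b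
  -- w))`; as `q m (p b w)` has no component above `b`, the powers recombine to `scale p L a`.
  rw [iter_comm (L' := L) fun z => (map_twist hp hp (fun i z => (hpL i z).symm) (fun _ => rfl)
    (fun i z => (hqL i z).symm) m z).symm, twist_proj hp,
    ← scale_eq_pow_scale hp (not_lt.1 hb)]
  intro c hc
  by_cases hmc : m < c
  · exact hpq.left c m _ hmc
  · rw [hpq.right m b _ (by omega), map_zero]

lemma isResolution_twist (hp : IsResolution p) (hq : IsResolution q) (hpq : Compatible p q)
    (hpL : ∀ i z, p i (L z) = L (p i z)) (hqL : ∀ i z, q i (L z) = L (q i z)) :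
    IsResolution (twist p q L) := by
  -- On `p a z` a composite of twists is `scale p L a` of the corresponding composite of `q`'s, so
  -- idempotence and orthogonality carry over from `q`.
  have key : ∀ m l a z, twist p q L m (twist p q L l (p a z))
      = scale p L a (q m (q l (p a z))) := fun m l a z => by
    rw [twist_proj hp, twist_scale hp hpq hpL hqL]
    intro b hb
    by_cases hlb : l < b
    · exact hpq.left b l _ hlb
    · rw [hpq.right l a _ (by omega), map_zero]
  refine ⟨fun m => ?_, fun m l z hml => ?_, fun z => ?_⟩
  · refine DFunLike.congr_fun (f := (twist p q L m).comp (twist p q L m)) (g := twist p q L m) ?_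
    refine hp.hom_ext fun a z => ?_
    rw [AddMonoidHom.comp_apply, key, hq.idem, twist_proj hp]
  · refine DFunLike.congr_fun (f := (twist p q L m).comp (twist p q L l)) (g := 0) ?_ z
    refine hp.hom_ext fun a z => ?_
    rw [AddMonoidHom.comp_apply, key, hq.orth m l _ hml, map_zero, AddMonoidHom.zero_apply]
  · classical
    obtain ⟨T, hT⟩ := hp.exists_sum z
    choose T' hT' using fun a => hq.exists_sum (p a z)
    refine ⟨T.biUnion T', ?_⟩
    conv_lhs =>
      enter [2, i]
      rw [← hT, map_sum]
    rw [Finset.sum_comm]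
    conv_rhs => rw [← hT]
    refine Finset.sum_congr rfl fun a ha => ?_
    have h := hq.sum_mono (hT' a) (Finset.subset_biUnion_of_mem T' ha)
    simp only [twist_proj hp]
    -- On the `a`-th summand the twists add up to `scale p L a (p a z)`, whose exponent is `a - a =
    -- 0`.
    rw [← map_sum, h, scale_proj hp, sub_self, Int.toNat_zero]
    rfl

lemma twist_one (hp : IsResolution p) (hL : ∀ z, L z = z) (m : ℤ) (z : S) :
    twist p q L m z = q m z := by
  obtain rfl : L = AddMonoidHom.id S := AddMonoidHom.ext hL
  have hs : ∀ a z, scale p (AddMonoidHom.id S) a z = z := fun a z => by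
    obtain ⟨T, hT⟩ := hp.exists_sum z
    rw [scale, hp.sumHom_apply _ hT]
    conv_rhs => rw [← hT]
    exact Finset.sum_congr rfl fun j _ => iter_id _ _
  obtain ⟨T, hT⟩ := hp.exists_sum z
  rw [twist, hp.sumHom_apply _ hT]
  conv_rhs => rw [← hT, map_sum]
  exact Finset.sum_congr rfl fun j _ => hs _ _

/-- Since `0 ^ (a - j)` survives only for `j = a`, the twist of `p a z` is `p a (q m (p a z))`. By
compatibility this is `0` unless `m = a`, when it is `p a z`. -/
lemma twist_zero (hp : IsResolution p) (hq : IsResolution q) (hpq : Compatible p q)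
    (hL : ∀ z, L z = 0) (m : ℤ) (z : S) : twist p q L m z = p m z := by
  obtain rfl : L = 0 := AddMonoidHom.ext hL
  refine DFunLike.congr_fun (f := twist p q 0 m) (g := p m) ?_ z
  refine hp.hom_ext fun a z => ?_
  rw [twist_proj hp]
  have hu : ∀ c, a < c → p c (q m (p a z)) = 0 := fun c hc => by
    by_cases hmc : m < c
    · exact hpq.left c m _ hmc
    · rw [hpq.right m a _ (by omega), map_zero]
  have hs : scale p 0 a (q m (p a z)) = p a (q m (p a z)) := by
    classical
    obtain ⟨T, hT⟩ := hp.exists_sum (q m (p a z))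
    have hT := hp.sum_mono hT (Finset.subset_insert a T)
    rw [scale, hp.sumHom_apply _ hT,
      Finset.sum_eq_single_of_mem a (Finset.mem_insert_self a T), sub_self, Int.toNat_zero]
    · rfl
    · intro c _ hca
      by_cases hc : a < c
      · rw [hu c hc, map_zero]
      · obtain ⟨n, hn⟩ : ∃ n, (a - c).toNat = n + 1 := ⟨(a - c).toNat - 1, by omega⟩
        rw [hn]
        exact map_zero (iter 0 n)
  rw [hs]
  rcases lt_trichotomy m a with h | rfl | h
  · rw [hpq.left a m _ h, hp.orth m a _ h.ne]
  · rw [hpq.proj_proj_proj hp hq, hp.idem]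
  · rw [hpq.right m a _ h, map_zero, hp.orth m a _ h.ne']

/-- Each term of the twist lies in some summand `j` of `p`, and `p j ∘ q m = 0` for `j > m`; only
summands with `j ≤ m` contribute. -/
lemma twist_mem (hp : IsResolution p) (hpq : Compatible p q)
    (hpL : ∀ i z, p i (L z) = L (p i z)) {F : AddSubgroup S} {m : ℤ}
    (hF : ∀ j z, j ≤ m → p j z ∈ F) (z : S) : twist p q L m z ∈ F := by
  refine hp.sumHom_mem _ fun a => hp.sumHom_mem _ fun j => ?_
  rw [← iter_comm (A := p j) fun z => hpL j z]
  by_cases hj : j ≤ m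
  · exact hF j _ hj
  · rw [iter_comm (A := p j) fun z => hpL j z, hpq.left j m _ (by omega), map_zero]
    exact F.zero_mem

end

end IsResolution

end Resolution

/-! ## Splittings of a sheaf of graded modules -/

section Splitting

open Topology Filter

variable {X : Type u} [TopologicalSpace X] {O : GrRingSheaf X}

/-- The part of the stalk generated by germs of degree at most `m`. -/
def GrModSheaf.filtration (B : GrModSheaf O) (m k : ℤ) (y : X) : AddSubgroup (B.Stalk k y) :=
  AddSubgroup.closure {z | ∃ (i j : ℤ) (h : i + j = k) (_ : j ≤ m) (U : Opens X) (hy : y ∈ U)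
    (a : O.sec i U) (w : B.Stalk j y), B.stalkSmul h a hy w = z}

/-- The endomorphisms `P m` of the stalks at `y` are the projections of a decomposition
`B = ⨁ O ⊗ H m`, where `H m` consists of germs of degree `m`. -/
structure GrModSheaf.IsSplittingAt (B : GrModSheaf O)
    (P : ∀ (_m k : ℤ) (y : X), B.Stalk k y →+ B.Stalk k y) (y : X) : Prop where
  isResolution : ∀ k, IsResolution fun m => P m k y
  map_smul : ∀ (m : ℤ) {i j k : ℤ} (h : i + j = k) {U : Opens X} (a : O.sec i U) (hy : y ∈ U)
    (z : B.Stalk j y), P m k y (B.stalkSmul h a hy z) = B.stalkSmul h a hy (P m j y z)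
  -- The `m`-th summand has nothing below degree `m`, while `mem` bounds the degrees of its
  -- generators above by `m`; together these force generation in degree exactly `m`.
  eq_zero : ∀ {m k : ℤ}, k < m → ∀ z, P m k y z = 0
  mem : ∀ (m k : ℤ) z, P m k y z ∈ B.filtration m k y

namespace GrModSheaf

variable {B : GrModSheaf O} {P Q : ∀ (_m k : ℤ) (y : X), B.Stalk k y →+ B.Stalk k y} {y : X}

/-- By linearity it is enough to treat the generators, which have degree at most `m < l`, where `P
l` is zero. -/
lemma IsSplittingAt.eq_zero_of_mem (hP : B.IsSplittingAt P y) {m l k : ℤ} (h : m < l)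
    {z : B.Stalk k y} (hz : z ∈ B.filtration m k y) : P l k y z = 0 := by
  have : B.filtration m k y ≤ (P l k y).ker := by
    rw [filtration, AddSubgroup.closure_le]
    rintro _ ⟨i, j, hij, hj, U, hy, a, w, rfl⟩
    change P l k y _ = 0
    rw [hP.map_smul, hP.eq_zero (hj.trans_lt h), map_zero]
  exact this hz

lemma IsSplittingAt.compatible (hP : B.IsSplittingAt P y) (hQ : B.IsSplittingAt Q y) (k : ℤ) :
    IsResolution.Compatible (fun m => P m k y) (fun m => Q m k y) :=
  ⟨fun _ j _ h => hP.eq_zero_of_mem h (hQ.mem j k _),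
    fun _ j _ h => hQ.eq_zero_of_mem h (hP.mem j k _)⟩

/-- A splitting near `x` that takes sections to sections. -/
structure IsRegularSplittingAt (B : GrModSheaf O)
    (P : ∀ (_m k : ℤ) (y : X), B.Stalk k y →+ B.Stalk k y) (x : X) : Prop extends
    B.IsSplittingAt P x where
  isRegularAt : ∀ m k, GrPresheaf.IsRegularAt (P m k) x

lemma IsRegularSplittingAt.congr {x : X} (hP : B.IsRegularSplittingAt P x)
    (h : ∀ᶠ y in 𝓝 x, ∀ m k, P m k y = Q m k y) : B.IsRegularSplittingAt Q x where
  isResolution k := by simpa only [← h.self_of_nhds] using hP.isResolution k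
  map_smul := by simpa only [← h.self_of_nhds] using hP.map_smul
  eq_zero h' z := by simpa only [← h.self_of_nhds] using hP.eq_zero h' z
  mem := by simpa only [← h.self_of_nhds] using hP.mem
  isRegularAt m k := (hP.isRegularAt m k).congr (h.mono fun _ hy => hy m k)

/-! ### Deformation of splittings -/

/-- A finite set of indices that suffices for the germ at `x` suffices at all nearby points, since
equal germs at `x` are equal around `x`. So the pointwise finite sum is, near `x`, one fixed finite
sum of sections. -/
lemma isRegularAt_sumHom {k l : ℤ} {C : GrModSheaf O} {p : ℤ → ∀ y, B.Stalk k y →+ B.Stalk k y}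
    {φ : ℤ → ∀ y, B.Stalk k y →+ C.Stalk l y} {x : X}
    (hp : ∀ᶠ y in 𝓝 x, IsResolution fun m => p m y)
    (hpr : ∀ m, GrPresheaf.IsRegularAt (p m) x) (hφ : ∀ m, GrPresheaf.IsRegularAt (φ m) x) :
    GrPresheaf.IsRegularAt
      (fun y => IsResolution.sumHom (fun m => p m y) (fun m => φ m y)) x := by
  intro s hs
  obtain ⟨T, hT⟩ := hp.self_of_nhds.exists_sum (s x)
  have h := GrPresheaf.IsSectionAt.eventually_eq
    (GrPresheaf.IsSectionAt.sum T fun i _ => hpr i s hs) hs hT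
  refine (GrPresheaf.IsSectionAt.sum T fun i _ => hφ i _ (hpr i s hs)).congr ?_
  filter_upwards [hp, h] with y hy hy'
  rw [hy.sumHom_apply _ hy']

/-- The deformation of the splitting `P` in the direction of `Q`, of amount given by `L`. -/
def deform (L : ∀ (k : ℤ) (y : X), B.Stalk k y →+ B.Stalk k y)
    (P Q : ∀ (_m k : ℤ) (y : X), B.Stalk k y →+ B.Stalk k y)
    (m k : ℤ) (y : X) : B.Stalk k y →+ B.Stalk k y :=
  IsResolution.twist (fun m => P m k y) (fun m => Q m k y) (L k y) m

variable {L : ∀ (k : ℤ) (y : X), B.Stalk k y →+ B.Stalk k y}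

lemma IsSplittingAt.deform (hP : B.IsSplittingAt P y) (hQ : B.IsSplittingAt Q y)
    (hPL : ∀ m k z, P m k y (L k y z) = L k y (P m k y z))
    (hQL : ∀ m k z, Q m k y (L k y z) = L k y (Q m k y z))
    (hL : ∀ {i j k : ℤ} (h : i + j = k) {U : Opens X} (a : O.sec i U) (hy : y ∈ U)
      (z : B.Stalk j y), L k y (B.stalkSmul h a hy z) = B.stalkSmul h a hy (L j y z)) :
    B.IsSplittingAt (deform L P Q) y where
  isResolution k := (hP.isResolution k).isResolution_twist (hQ.isResolution k)
    (hP.compatible hQ k) (fun m => hPL m k) (fun m => hQL m k)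
  map_smul m {i j k} h U a hy z :=
    -- The twist is natural for maps commuting with `P`, `Q` and `L`, and multiplication by `a` is
    -- such a map.
    ((hP.isResolution j).map_twist (hP.isResolution k) (A := B.stalkSmul h a hy)
      (fun i z => (hP.map_smul i h a hy z).symm) (fun z => (hL h a hy z).symm)
      (fun i z => (hQ.map_smul i h a hy z).symm) m z).symm
  eq_zero {m k} h z := by
    obtain ⟨T, hT⟩ := (hP.isResolution k).exists_sum z
    rw [GrModSheaf.deform, IsResolution.twist, (hP.isResolution k).sumHom_apply _ hT]
    refine Finset.sum_eq_zero fun i _ => ?_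
    rw [AddMonoidHom.comp_apply, hQ.eq_zero h, map_zero]
  mem m k z := by
    refine (hP.isResolution k).twist_mem (hP.compatible hQ k) (fun m => hPL m k) ?_ z
    intro j w hj
    refine AddSubgroup.closure_mono ?_ (hP.mem j k w)
    rintro _ ⟨i, j', h, hj', r⟩
    exact ⟨i, j', h, hj'.trans hj, r⟩

lemma isRegularAt_iter {k : ℤ} {x : X} (hL : GrPresheaf.IsRegularAt (L k) x) (n : ℕ) :
    GrPresheaf.IsRegularAt (fun y => IsResolution.iter (L k y) n) x := by
  induction n with
  | zero => exact fun _ h => h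
  | succ n ih => exact fun φ h => ih _ (hL φ h)

lemma isRegularAt_deform {x : X} (hP : ∀ᶠ y in 𝓝 x, B.IsSplittingAt P y)
    (hPr : ∀ m k, GrPresheaf.IsRegularAt (P m k) x)
    (hQr : ∀ m k, GrPresheaf.IsRegularAt (Q m k) x)
    (hL : ∀ k, GrPresheaf.IsRegularAt (L k) x) (m k : ℤ) :
    GrPresheaf.IsRegularAt (deform L P Q m k) x := by
  have h := hP.mono fun y hy => hy.isResolution k
  refine isRegularAt_sumHom h (fun m => hPr m k) fun a φ hφ => ?_
  exact isRegularAt_sumHom h (fun m => hPr m k) (fun j => isRegularAt_iter (hL k) _) _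
    (hQr m k φ hφ)

lemma IsSplittingAt.deform_of_eq_id (hP : B.IsSplittingAt P y) (hL : ∀ k z, L k y z = z)
    (m k : ℤ) : GrModSheaf.deform L P Q m k y = Q m k y :=
  AddMonoidHom.ext fun z => (hP.isResolution k).twist_one (hL k) m z

lemma IsSplittingAt.deform_of_eq_zero (hP : B.IsSplittingAt P y) (hQ : B.IsSplittingAt Q y)
    (hL : ∀ k z, L k y z = 0) (m k : ℤ) : GrModSheaf.deform L P Q m k y = P m k y :=
  AddMonoidHom.ext fun z =>
    (hP.isResolution k).twist_zero (hQ.isResolution k) (hP.compatible hQ k) (hL k) m z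

/-! ### The splitting defined by a frame -/

section Frame

variable {U : Opens X} {r : ℤ → ℕ} (e : ∀ j : (Σ i : ℤ, Fin (r i)), B.sec j.1 U)

/-- The combination of the sections `e` with coefficients `c`. -/
def frameSum (k : ℤ) {V : Opens X} (hV : V ≤ U) :
    (Π₀ j : (Σ i : ℤ, Fin (r i)), O.sec (k - j.1) V) →+ B.sec k V :=
  DFinsupp.sumAddHom fun j => (B.smul (sub_add_cancel k j.1)).flip (B.res hV (e j))

/-- Restriction of coefficients. -/
def resCoeff (r : ℤ → ℕ) (k : ℤ) {V W : Opens X} (hW : W ≤ V) :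
    (Π₀ j : (Σ i : ℤ, Fin (r i)), O.sec (k - j.1) V) →+
      Π₀ j : (Σ i : ℤ, Fin (r i)), O.sec (k - j.1) W :=
  DFinsupp.mapRange.addMonoidHom fun _ => O.res hW

/-- Multiplication of coefficients. -/
def smulCoeff (r : ℤ → ℕ) {i k l : ℤ} (h : i + k = l) {V : Opens X} (a : O.sec i V) :
    (Π₀ j : (Σ i : ℤ, Fin (r i)), O.sec (k - j.1) V) →+
      Π₀ j : (Σ i : ℤ, Fin (r i)), O.sec (l - j.1) V :=
  DFinsupp.mapRange.addMonoidHom fun _ => O.mul (by omega) a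

/-- Coefficients of the frame elements of degree `m`. -/
def filterCoeff (O : GrRingSheaf X) (r : ℤ → ℕ) (m k : ℤ) (V : Opens X) :
    (Π₀ j : (Σ i : ℤ, Fin (r i)), O.sec (k - j.1) V) →+
      Π₀ j : (Σ i : ℤ, Fin (r i)), O.sec (k - j.1) V :=
  DFinsupp.filterAddMonoidHom _ fun j => j.1 = m

lemma filterCoeff_apply (m k : ℤ) {V : Opens X}
    (c : Π₀ j : (Σ i : ℤ, Fin (r i)), O.sec (k - j.1) V) (j) :
    filterCoeff O r m k V c j = if j.1 = m then c j else 0 :=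
  DFinsupp.filter_apply _ _ _

lemma filterCoeff_resCoeff (m k : ℤ) {V W : Opens X} (hW : W ≤ V)
    (c : Π₀ j : (Σ i : ℤ, Fin (r i)), O.sec (k - j.1) V) :
    filterCoeff O r m k W (resCoeff r k hW c) = resCoeff r k hW (filterCoeff O r m k V c) := by
  ext j
  have h : ∀ c' : Π₀ j : (Σ i : ℤ, Fin (r i)), O.sec (k - j.1) V,
    resCoeff r k hW c' j = O.res hW (c' j) := fun _ => rfl
  rw [filterCoeff_apply, h, h, filterCoeff_apply]
  split_ifs <;> simp

lemma filterCoeff_smulCoeff (m : ℤ) {i k l : ℤ} (h : i + k = l) {V : Opens X} (a : O.sec i V)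
    (c : Π₀ j : (Σ i : ℤ, Fin (r i)), O.sec (k - j.1) V) :
    filterCoeff O r m l V (smulCoeff r h a c) = smulCoeff r h a (filterCoeff O r m k V c) := by
  ext j
  have h : ∀ c' : Π₀ j : (Σ i : ℤ, Fin (r i)), O.sec (k - j.1) V,
    smulCoeff r h a c' j = O.mul (by omega) a (c' j) := fun _ => rfl
  rw [filterCoeff_apply, h, h, filterCoeff_apply]
  split_ifs <;> simp

lemma frameSum_single (k : ℤ) {V : Opens X} (hV : V ≤ U) (j : Σ i : ℤ, Fin (r i))
    (a : O.sec (k - j.1) V) : frameSum e k hV (DFinsupp.single j a)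
      = B.smul (sub_add_cancel k j.1) a (B.res hV (e j)) :=
  DFinsupp.sumAddHom_single _ _ _

lemma res_frameSum (k : ℤ) {V W : Opens X} (hV : V ≤ U) (hW : W ≤ V)
    (c : Π₀ j : (Σ i : ℤ, Fin (r i)), O.sec (k - j.1) V) :
    B.res hW (frameSum e k hV c) = frameSum e k (hW.trans hV) (resCoeff r k hW c) := by
  refine DFunLike.congr_fun (f := (B.res hW).comp (frameSum e k hV))
    (g := (frameSum e k (hW.trans hV)).comp (resCoeff r k hW)) ?_ c
  refine DFinsupp.addHom_ext fun j a => ?_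
  rw [AddMonoidHom.comp_apply, AddMonoidHom.comp_apply, frameSum_single, resCoeff,
    DFinsupp.mapRange.addMonoidHom_apply, DFinsupp.mapRange_single, frameSum_single, B.res_smul,
    B.res_res]

lemma smul_frameSum {i k l : ℤ} (h : i + k = l) {V : Opens X} (hV : V ≤ U) (a : O.sec i V)
    (c : Π₀ j : (Σ i : ℤ, Fin (r i)), O.sec (k - j.1) V) :
    B.smul h a (frameSum e k hV c) = frameSum e l hV (smulCoeff r h a c) := by
  refine DFunLike.congr_fun (f := (B.smul h a).comp (frameSum e k hV))
    (g := (frameSum e l hV).comp (smulCoeff r h a)) ?_ c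
  refine DFinsupp.addHom_ext fun j b => ?_
  rw [AddMonoidHom.comp_apply, AddMonoidHom.comp_apply, frameSum_single, smulCoeff,
    DFinsupp.mapRange.addMonoidHom_apply, DFinsupp.mapRange_single, frameSum_single,
    B.mul_smul]

variable {e}

lemma IsFrame.frameSum_injective (he : B.IsFrame U r e) (k : ℤ) {V : Opens X} (hV : V ≤ U) :
    Function.Injective (frameSum e k hV) := by
  classical
  rw [injective_iff_map_eq_zero]
  intro c hc
  have := (he V hV k).1 c.support c
  rw [frameSum, DFinsupp.sumAddHom_apply] at hc
  have := this hc
  ext j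
  by_cases hj : j ∈ c.support
  · exact this j hj
  · simpa using hj

lemma IsFrame.exists_frameSum (he : B.IsFrame U r e) {k : ℤ} {V : Opens X} (hV : V ≤ U)
    (s : B.sec k V) {x : X} (hx : x ∈ V) : ∃ (W : Opens X) (hW : W ≤ V) (_ : x ∈ W)
      (c : Π₀ j : (Σ i : ℤ, Fin (r i)), O.sec (k - j.1) W),
      B.res hW s = frameSum e k (hW.trans hV) c := by
  obtain ⟨W, hW, hxW, t, c, h⟩ := (he V hV k).2 s x hx
  refine ⟨W, hW, hxW, ∑ j ∈ t, DFinsupp.single j (c j), ?_⟩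
  rw [h, map_sum]
  exact Finset.sum_congr rfl fun j _ => (frameSum_single ..).symm

lemma IsFrame.exists_germ_frameSum (he : B.IsFrame U r e) {k : ℤ} (hy : y ∈ U) {U' : Opens X}
    (hy' : y ∈ U') (z : B.Stalk k y) : ∃ (W : Opens X) (_ : W ≤ U') (hW : W ≤ U) (hyW : y ∈ W)
      (c : Π₀ j : (Σ i : ℤ, Fin (r i)), O.sec (k - j.1) W),
      B.germ hyW (frameSum e k hW c) = z := by
  have hUU : y ∈ U ⊓ U' := ⟨hy, hy'⟩
  obtain ⟨V, hV, hyV, s, rfl⟩ := B.exists_germ_le hUU z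
  obtain ⟨W, hW, hyW, c, h⟩ := he.exists_frameSum (hV.trans inf_le_left) s hyV
  refine ⟨W, hW.trans (hV.trans inf_le_right), hW.trans (hV.trans inf_le_left), hyW, c, ?_⟩
  rw [← h, B.germ_res]

/-- Coefficients in a frame are unique over small enough neighbourhoods, so selecting those of
degree `m` is well defined on germs. -/
lemma IsFrame.germ_filter_eq (he : B.IsFrame U r e) (m : ℤ) {k : ℤ} {V V' : Opens X}
    (hV : V ≤ U) (hV' : V' ≤ U) (hy : y ∈ V) (hy' : y ∈ V')
    (c : Π₀ j : (Σ i : ℤ, Fin (r i)), O.sec (k - j.1) V)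
    (c' : Π₀ j : (Σ i : ℤ, Fin (r i)), O.sec (k - j.1) V')
    (h : B.germ hy (frameSum e k hV c) = B.germ hy' (frameSum e k hV' c')) :
    B.germ hy (frameSum e k hV (filterCoeff O r m k V c))
      = B.germ hy' (frameSum e k hV' (filterCoeff O r m k V' c')) := by
  obtain ⟨W, hW, hW', hyW, h⟩ := B.exists_res_eq_res hy hy' _ _ h
  rw [res_frameSum, res_frameSum] at h
  have h := he.frameSum_injective k _ h
  rw [← B.germ_res hW hyW, ← B.germ_res hW' hyW, res_frameSum, res_frameSum,
    ← filterCoeff_resCoeff, ← filterCoeff_resCoeff, h]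

lemma IsFrame.exists_proj (he : B.IsFrame U r e) (m k : ℤ) (y : X) :
    ∃ f : B.Stalk k y →+ B.Stalk k y, ∀ {V : Opens X} (hV : V ≤ U) (hy : y ∈ V)
      (c : Π₀ j : (Σ i : ℤ, Fin (r i)), O.sec (k - j.1) V),
      f (B.germ hy (frameSum e k hV c))
        = B.germ hy (frameSum e k hV (filterCoeff O r m k V c)) := by
  by_cases hy : y ∈ U
  · choose W _ hW hyW c hc using fun z => he.exists_germ_frameSum (k := k) hy hy z
    -- An arbitrary representative is chosen for each germ; additivity follows from independence of
    -- that choice.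
    refine ⟨AddMonoidHom.mk' (fun z => B.germ (hyW z)
      (frameSum e k (hW z) (filterCoeff O r m k _ (c z)))) fun z w => ?_, fun hV hy' c' => ?_⟩
    · have hyV : y ∈ W z ⊓ W w := ⟨hyW z, hyW w⟩
      have h := he.germ_filter_eq m (hW (z + w)) (inf_le_left.trans (hW z)) (hyW (z + w)) hyV
        (c (z + w)) (resCoeff r k inf_le_left (c z) + resCoeff r k inf_le_right (c w)) (by
          rw [hc, map_add, ← res_frameSum e k (hW z), ← res_frameSum e k (hW w), map_add,
            B.germ_res, B.germ_res, hc, hc])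
      rw [h, map_add, map_add, filterCoeff_resCoeff, filterCoeff_resCoeff,
        ← res_frameSum e k (hW z), ← res_frameSum e k (hW w), map_add, B.germ_res, B.germ_res]
    · exact he.germ_filter_eq m _ _ _ _ _ _ (hc _)
  -- Outside `U` the requirement is vacuous and the zero map serves.
  · exact ⟨0, fun hV hy' => absurd (hV hy') hy⟩

/-- The projections of the splitting defined by a frame. -/
def IsFrame.proj (he : B.IsFrame U r e) (m k : ℤ) (y : X) : B.Stalk k y →+ B.Stalk k y :=
  (he.exists_proj m k y).choose

lemma IsFrame.proj_germ (he : B.IsFrame U r e) (m k : ℤ) {V : Opens X} (hV : V ≤ U) (hy : y ∈ V)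
    (c : Π₀ j : (Σ i : ℤ, Fin (r i)), O.sec (k - j.1) V) :
    he.proj m k y (B.germ hy (frameSum e k hV c))
      = B.germ hy (frameSum e k hV (filterCoeff O r m k V c)) :=
  (he.exists_proj m k y).choose_spec hV hy c

lemma IsFrame.proj_germ_self (he : B.IsFrame U r e) (j : Σ i : ℤ, Fin (r i)) (hy : y ∈ U) :
    he.proj j.1 j.1 y (B.germ hy (e j)) = B.germ hy (e j) := by
  have h0 : (0 : ℤ) = j.1 - j.1 := by omega
  -- The coefficient is the unit, but it must live in degree `j.1 - j.1`, which is only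
  -- propositionally `0`; generalizing that degree permits the substitution.
  obtain ⟨a, ha⟩ : ∃ a : O.sec (j.1 - j.1) U, B.smul (sub_add_cancel j.1 j.1) a (e j) = e j := by
    generalize_proofs h
    generalize j.1 - j.1 = i at h0 h
    subst h0
    exact ⟨O.one U, B.one_smul _⟩
  have h : frameSum e j.1 le_rfl (DFinsupp.single j a) = e j := by
    rw [frameSum_single, B.res_self, ha]
  have h' := he.proj_germ j.1 j.1 le_rfl hy (DFinsupp.single j a)
  rw [h] at h'
  rw [h', ← h]
  congr 2
  exact DFinsupp.filter_single_pos (β := fun l : Σ i : ℤ, Fin (r i) => O.sec (j.1 - l.1) U)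
    (p := fun l => l.1 = j.1) j a rfl

lemma IsFrame.isSplittingAt_proj (hO : ∀ k < 0, ∀ (U : Opens X) (a : O.sec k U), a = 0)
    (he : B.IsFrame U r e) (hy : y ∈ U) : B.IsSplittingAt he.proj y where
  isResolution k := by
    refine ⟨fun m z => ?_, fun m l z hml => ?_, fun z => ?_⟩
    · obtain ⟨W, -, hW, hyW, c, rfl⟩ := he.exists_germ_frameSum hy hy z
      rw [he.proj_germ, he.proj_germ]
      congr 2
      ext j
      simp only [filterCoeff_apply]
      split_ifs <;> rfl
    · obtain ⟨W, -, hW, hyW, c, rfl⟩ := he.exists_germ_frameSum hy hy z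
      rw [he.proj_germ, he.proj_germ]
      convert map_zero (B.germ (k := k) hyW)
      convert map_zero (frameSum e k hW)
      ext j
      simp only [filterCoeff_apply]
      split_ifs with h₁ h₂
      · exact absurd (h₁.symm.trans h₂) hml
      all_goals rfl
    · classical
      obtain ⟨W, -, hW, hyW, c, rfl⟩ := he.exists_germ_frameSum hy hy z
      refine ⟨c.support.image Sigma.fst, ?_⟩
      simp only [he.proj_germ]
      rw [← map_sum, ← map_sum]
      congr 2
      ext j
      rw [DFinsupp.finsetSum_apply]
      simp only [filterCoeff_apply, Finset.sum_ite_eq, Finset.mem_image]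
      split_ifs with h
      · rfl
      · by_contra hj
        exact h ⟨j, by simpa using fun h => hj h.symm, rfl⟩
  map_smul m {i j k} h U' a hy' z := by
    obtain ⟨W, hW', hW, hyW, c, rfl⟩ := he.exists_germ_frameSum hy hy' z
    rw [B.stalkSmul_germ h a hy' hW' hyW, smul_frameSum, he.proj_germ, he.proj_germ,
      B.stalkSmul_germ h a hy' hW' hyW, smul_frameSum, filterCoeff_smulCoeff]
  eq_zero {m k} h z := by
    obtain ⟨W, -, hW, hyW, c, rfl⟩ := he.exists_germ_frameSum hy hy z
    rw [he.proj_germ]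
    convert map_zero (B.germ (k := k) hyW)
    convert map_zero (frameSum e k hW)
    ext j
    rw [filterCoeff_apply]
    split_ifs with hj
    -- The coefficient has degree `k - m < 0`.
    · exact hO _ (by omega) _ _
    · rfl
  mem m k z := by
    classical
    obtain ⟨W, -, hW, hyW, c, rfl⟩ := he.exists_germ_frameSum hy hy z
    rw [he.proj_germ, frameSum, DFinsupp.sumAddHom_apply, DFinsupp.sum, map_sum]
    refine AddSubgroup.sum_mem _ fun j hj => AddSubgroup.subset_closure ?_
    refine ⟨_, _, sub_add_cancel k j.1, ?_, W, hyW, filterCoeff O r m k W c j,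
      B.germ hyW (B.res hW (e j)), ?_⟩
    · by_contra hjm
      refine (DFinsupp.mem_support_iff.1 hj) ?_
      rw [filterCoeff_apply, if_neg (by omega)]
    · exact (B.germ_smul ..).symm

lemma IsFrame.isRegularSplittingAt_proj
    (hO : ∀ k < 0, ∀ (U : Opens X) (a : O.sec k U), a = 0) (he : B.IsFrame U r e) (hy : y ∈ U) :
    B.IsRegularSplittingAt he.proj y where
  toIsSplittingAt := he.isSplittingAt_proj hO hy
  isRegularAt m k φ hφ := by
    obtain ⟨V, hV, hyV, s, hs⟩ := hφ.exists_le hy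
    obtain ⟨W, hW, hyW, c, hc⟩ := he.exists_frameSum hV s hyV
    refine ⟨W, hyW, frameSum e k (hW.trans hV) (filterCoeff O r m k W c), fun z hz => ?_⟩
    dsimp only
    rw [hs z (hW hz), ← B.germ_res hW hz, hc, he.proj_germ]

end Frame

end GrModSheaf

end Splitting

/-! ## Splittings of vector bundles over nonnegatively graded manifolds -/

section GlobalSplitting

open Topology Filter

variable {n : ℕ} {M : Type u} [TopologicalSpace M] [ChartedSpace (EuclideanSpace ℝ (Fin n)) M]
  {𝓜 : NManifold n M}

namespace NManifold

/-- Functions of degree `0` commute with all functions, the sign being trivial. Hence multiplication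
by a smooth function is linear on stalks and can serve as the parameter `L` of a deformation. -/
lemma fn_smul_comm (B : GrModSheaf 𝓜.toGrRingSheaf) {i j k : ℤ} (h : i + j = k) {U V : Opens M}
    (f : SmoothFun n M U) (a : 𝓜.sec i V) {y : M} (hU : y ∈ U) (hV : y ∈ V) (z : B.Stalk j y) :
    B.stalkSmul (zero_add k) (𝓜.fn U f) hU (B.stalkSmul h a hV z)
      = B.stalkSmul h a hV (B.stalkSmul (zero_add j) (𝓜.fn U f) hU z) := by
  have hUV : y ∈ U ⊓ V := ⟨hU, hV⟩
  rw [← B.stalkSmul_res _ (inf_le_left : U ⊓ V ≤ U) (𝓜.fn U f) hUV,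
    ← B.stalkSmul_res _ (inf_le_left : U ⊓ V ≤ U) (𝓜.fn U f) hUV,
    ← B.stalkSmul_res _ (inf_le_right : U ⊓ V ≤ V) a hUV,
    ← B.stalkSmul_res _ (inf_le_right : U ⊓ V ≤ V) a hUV,
    ← B.stalkSmul_mul (zero_add i) h, ← B.stalkSmul_mul (add_zero i) h,
    𝓜.comm (zero_add i) (add_zero i), zero_mul, Int.negOnePow_zero, one_smul]

/-- Multiplication by a smooth function on the stalks of a sheaf of modules. -/
def mulFn (B : GrModSheaf 𝓜.toGrRingSheaf) (f : SmoothFun n M ⊤) (k : ℤ) (y : M) :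
    B.Stalk k y →+ B.Stalk k y :=
  B.stalkSmul (zero_add k) (𝓜.fn ⊤ f) (Opens.mem_top y)

lemma isRegularAt_mulFn (B : GrModSheaf 𝓜.toGrRingSheaf) (f : SmoothFun n M ⊤) (k : ℤ) (x : M) :
    GrPresheaf.IsRegularAt (mulFn B f k) x := by
  rintro φ ⟨U, hU, s, hs⟩
  refine ⟨U, hU, B.smul (zero_add k) (𝓜.res le_top (𝓜.fn ⊤ f)) s, fun y hy => ?_⟩
  rw [B.germ_smul, B.stalkSmul_res, ← hs y hy]
  rfl

lemma mulFn_congr (B : GrModSheaf 𝓜.toGrRingSheaf) {f g : SmoothFun n M ⊤} {y : M}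
    (h : ∀ᶠ z in 𝓝 y, f ⟨z, trivial⟩ = g ⟨z, trivial⟩) (k : ℤ) : mulFn B f k y = mulFn B g k y := by
  obtain ⟨V, hV, hVo, hyV⟩ := eventually_nhds_iff.1 h
  have hyV : y ∈ (⟨V, hVo⟩ : Opens M) := hyV
  ext z
  rw [mulFn, mulFn, ← B.stalkSmul_res _ (le_top : ⟨V, hVo⟩ ≤ ⊤) (𝓜.fn ⊤ f) hyV,
    ← B.stalkSmul_res _ (le_top : ⟨V, hVo⟩ ≤ ⊤) (𝓜.fn ⊤ g) hyV, ← 𝓜.fn_res, ← 𝓜.fn_res]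
  congr 3
  ext w
  exact hV w.1 w.2

lemma mulFn_of_eventually_zero (B : GrModSheaf 𝓜.toGrRingSheaf) {f : SmoothFun n M ⊤} {y : M}
    (h : ∀ᶠ z in 𝓝 y, f ⟨z, trivial⟩ = 0) (k : ℤ) (z : B.Stalk k y) : mulFn B f k y z = 0 := by
  rw [mulFn_congr B (g := 0) h, mulFn, map_zero, B.stalkSmul_zero]

lemma mulFn_of_eventually_one (B : GrModSheaf 𝓜.toGrRingSheaf) {f : SmoothFun n M ⊤} {y : M}
    (h : ∀ᶠ z in 𝓝 y, f ⟨z, trivial⟩ = 1) (k : ℤ) (z : B.Stalk k y) : mulFn B f k y z = z := by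
  rw [mulFn_congr B (g := 1) h, mulFn, 𝓜.fn_one, B.stalkSmul_one]

/-- `P` has to split on a neighbourhood, because regularity uses its finite expansions at nearby
points; of `Q` only the properties at `x` enter. -/
lemma isRegularSplittingAt_deform {B : GrModSheaf 𝓜.toGrRingSheaf}
    {P Q : ∀ (_m k : ℤ) (y : M), B.Stalk k y →+ B.Stalk k y} {x : M}
    (hP : ∀ᶠ y in 𝓝 x, B.IsRegularSplittingAt P y) (hQ : B.IsRegularSplittingAt Q x)
    (f : SmoothFun n M ⊤) :
    B.IsRegularSplittingAt (GrModSheaf.deform (mulFn B f) P Q) x where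
  toIsSplittingAt := hP.self_of_nhds.toIsSplittingAt.deform hQ.toIsSplittingAt
    (fun m _ z => hP.self_of_nhds.map_smul m _ _ _ z) (fun m _ z => hQ.map_smul m _ _ _ z)
    (fun h _ a hy z => fn_smul_comm B h f a trivial hy z)
  isRegularAt := GrModSheaf.isRegularAt_deform (hP.mono fun _ h => h.toIsSplittingAt)
    hP.self_of_nhds.isRegularAt hQ.isRegularAt (isRegularAt_mulFn B f · x)

/-- A splitting can be modified on the support of a bump function so as to become a splitting
where that function is `1`, provided that there is a splitting near the support. -/
lemma exists_extend_splitting (B : GrModSheaf 𝓜.toGrRingSheaf)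
    (P Q : ∀ (_m k : ℤ) (y : M), B.Stalk k y →+ B.Stalk k y) {f : M → ℝ}
    (hf : ContMDiff (𝓡 n) 𝓘(ℝ, ℝ) ∞ f) {U : Opens M} (hU : tsupport f ⊆ U)
    (hQ : ∀ y ∈ U, B.IsRegularSplittingAt Q y) :
    ∃ P' : ∀ (_m k : ℤ) (y : M), B.Stalk k y →+ B.Stalk k y,
      (∀ y ∉ tsupport f, ∀ m k, P' m k y = P m k y) ∧
      ∀ x, ((∀ᶠ y in 𝓝 x, B.IsRegularSplittingAt P y) ∨ ∀ᶠ y in 𝓝 x, f y = 1) →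
        ∀ᶠ y in 𝓝 x, B.IsRegularSplittingAt P' y := by
  classical
  let g : SmoothFun n M ⊤ := ⟨fun y => f y.1, hf.comp contMDiff_subtype_val⟩
  -- Where `f` is locally `1`, the family `Q` is used directly, since `P` need not be a splitting
  -- there and the deformation would be meaningless.
  let P' : ∀ (_m k : ℤ) (y : M), B.Stalk k y →+ B.Stalk k y := fun m k y =>
    if y ∉ tsupport f then P m k y
    else if ∀ᶠ z in 𝓝 y, f z = 1 then Q m k y
    else GrModSheaf.deform (mulFn B g) P Q m k y
  have h₀ : ∀ y ∉ tsupport f, ∀ m k, P' m k y = P m k y := fun y hy m k => if_pos hy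
  have h₁ : ∀ y, (∀ᶠ z in 𝓝 y, f z = 1) → y ∈ tsupport f ∧ ∀ m k, P' m k y = Q m k y := by
    intro y hy
    have hys : y ∈ tsupport f := subset_tsupport f (by
      rw [Function.mem_support, hy.self_of_nhds]; exact one_ne_zero)
    exact ⟨hys, fun m k => by simp only [P', hys, not_true_eq_false, if_false, hy, if_true]⟩
  -- Wherever both families split, the three cases agree with the deformation, by its values at `0`
  -- and `1`; so the cases fit together across their boundaries.
  have h₂ : ∀ y ∈ U, B.IsRegularSplittingAt P y → ∀ m k,
      GrModSheaf.deform (mulFn B g) P Q m k y = P' m k y := by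
    intro y hyU hy m k
    by_cases hys : y ∉ tsupport f
    · rw [h₀ y hys]
      refine hy.toIsSplittingAt.deform_of_eq_zero (hQ y hyU).toIsSplittingAt
        (mulFn_of_eventually_zero B ?_) m k
      filter_upwards [(isClosed_tsupport f).isOpen_compl.mem_nhds hys] with z hz
      exact image_eq_zero_of_notMem_tsupport (f := f) hz
    · by_cases hy1 : ∀ᶠ z in 𝓝 y, f z = 1
      · rw [(h₁ y hy1).2]
        exact hy.toIsSplittingAt.deform_of_eq_id (mulFn_of_eventually_one B hy1) m k
      · simp only [P', hys, if_false, hy1]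
  have key : ∀ x, ((∀ᶠ y in 𝓝 x, B.IsRegularSplittingAt P y) ∨ ∀ᶠ y in 𝓝 x, f y = 1) →
      B.IsRegularSplittingAt P' x := by
    rintro x (hx | hx)
    · by_cases hxs : x ∉ tsupport f
      · refine hx.self_of_nhds.congr ?_
        filter_upwards [(isClosed_tsupport f).isOpen_compl.mem_nhds hxs] with z hz m k
        exact (h₀ z hz m k).symm
      · have hxU : x ∈ U := hU (not_not.1 hxs)
        refine (isRegularSplittingAt_deform hx (hQ x hxU) g).congr ?_
        filter_upwards [hx, U.isOpen.mem_nhds hxU] with y hy hyU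
        exact h₂ y hyU hy
    · refine (hQ x (hU (h₁ x hx).1)).congr ?_
      filter_upwards [eventually_eventually_nhds.2 hx] with y hy m k
      exact ((h₁ y hy).2 m k).symm
  refine ⟨P', h₀, fun x hx => ?_⟩
  rcases hx with hx | hx
  · exact (eventually_eventually_nhds.2 hx).mono fun y hy => key y (.inl hy)
  · exact (eventually_eventually_nhds.2 hx).mono fun y hy => key y (.inr hy)

/-- A sheaf of modules that splits locally splits globally. No bound on the degrees is needed:
deformations scale the components of a splitting, so locally finite sums stay locally finite. -/
theorem exists_isRegularSplittingAt [T2Space M] [SecondCountableTopology M]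
    [IsManifold (𝓡 n) ∞ M] (B : GrModSheaf 𝓜.toGrRingSheaf)
    (h : ∀ x : M, ∃ (U : Opens M) (P : ∀ (_m k : ℤ) (y : M), B.Stalk k y →+ B.Stalk k y),
      x ∈ U ∧ ∀ y ∈ U, B.IsRegularSplittingAt P y) :
    ∃ P : ∀ (_m k : ℤ) (y : M), B.Stalk k y →+ B.Stalk k y, ∀ y, B.IsRegularSplittingAt P y := by
  classical
  have : LocallyCompactSpace M := ChartedSpace.locallyCompactSpace (EuclideanSpace ℝ (Fin n)) M
  choose U Q hxU hQ using h
  obtain ⟨ι, f, hf⟩ := SmoothBumpCovering.exists_isSubordinate (𝓡 n) (s := Set.univ)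
    (U := fun x : M => (U x : Set M)) isClosed_univ fun x _ => (U x).isOpen.mem_nhds (hxU x)
  have hne : ∀ i, (Function.support (f i)).Nonempty := fun i =>
    ⟨f.c i, by rw [Function.mem_support, (f i).eq_one]; exact one_ne_zero⟩
  -- A locally finite family with nonempty supports is countable here, so the bump functions can be
  -- processed one after the other.
  let enc : Encodable ι := f.locallyFinite.encodable hne
  choose next hnext hnext' using fun (P : ∀ (_m k : ℤ) (y : M), B.Stalk k y →+ B.Stalk k y)
    (i : ι) => exists_extend_splitting B P (Q (f.c i)) (f i).contMDiff (hf i) (hQ (f.c i))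
  -- The starting family is zero and splits nothing in general; the domain of splitting grows with
  -- each bump function. With `decode₂`, stage `N` treats the index whose code is exactly `N`, and
  -- does nothing if there is none.
  let P : ℕ → ∀ (_m k : ℤ) (y : M), B.Stalk k y →+ B.Stalk k y := fun N =>
    Nat.rec (fun _ _ _ => 0) (fun N P => (Encodable.decode₂ ι N).elim P (next P)) N
  have hP : ∀ N, P (N + 1) = (Encodable.decode₂ ι N).elim (P N) (next (P N)) := fun _ => rfl
  have hmono : ∀ x N N', N ≤ N' → (∀ᶠ y in 𝓝 x, B.IsRegularSplittingAt (P N) y) →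
      ∀ᶠ y in 𝓝 x, B.IsRegularSplittingAt (P N') y := by
    intro x N N' hN h
    induction N', hN using Nat.le_induction with
    | base => exact h
    | succ N' _ ih =>
      rw [hP]
      rcases Encodable.decode₂ ι N' with _ | i
      · exact ih
      · exact hnext' _ i x (.inl ih)
  have hgood : ∀ x N, enc.encode (f.ind x trivial) < N →
      ∀ᶠ y in 𝓝 x, B.IsRegularSplittingAt (P N) y := by
    intro x N hN
    refine hmono x _ N hN ?_
    -- The bump function attached to `x` is `1` near `x`, so its stage produces a splitting there
    -- whatever came before; `hmono` preserves it.
    rw [Nat.succ_eq_add_one, hP, Encodable.encodek₂]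
    exact hnext' _ _ x (.inr (f.eventuallyEq_one x trivial))
  have hconst : ∀ x, ∃ N₀, ∀ᶠ y in 𝓝 x, ∀ N ≥ N₀, ∀ m k, P N m k y = P N₀ m k y := by
    intro x
    obtain ⟨V, hV, hfin⟩ := f.locallyFinite.closure x
    obtain ⟨N₀, hN₀⟩ := (hfin.image enc.encode).bddAbove
    -- Only finitely many closed supports meet `V`, with codes at most `N₀`; from stage `N₀ + 1` on
    -- nothing changes over `V`.
    refine ⟨N₀ + 1, ?_⟩
    filter_upwards [hV] with y hy N hN m k
    induction N, hN using Nat.le_induction with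
    | base => rfl
    | succ N hN ih =>
      rw [hP, ← ih]
      rcases hd : Encodable.decode₂ ι N with _ | i
      · rfl
      · refine hnext _ i y (fun hyi => ?_) m k
        have h₁ := hN₀ ⟨i, ⟨y, hyi, hy⟩, rfl⟩
        rw [Encodable.decode₂_eq_some.1 hd] at h₁
        omega
  choose N₀ hN₀ using hconst
  -- The limit family takes at each point its stable value. Near `x` it equals one stage `N`, late
  -- enough for stabilization and for splitting; since `N₀ y` varies with `y`, the comparison passes
  -- through the larger of the two stages.
  refine ⟨fun m k y => P (N₀ y) m k y, fun x => ?_⟩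
  let N := max (N₀ x) (enc.encode (f.ind x trivial) + 1)
  refine (hgood x N (by omega)).self_of_nhds.congr ?_
  filter_upwards [hN₀ x] with y hy m k
  rw [hy N (le_max_left _ _), ← hy (max (N₀ x) (N₀ y)) (le_max_left _ _),
    (hN₀ y).self_of_nhds _ (le_max_right _ _)]

end NManifold

end GlobalSplitting

/-! ## Sections of associated sheaves -/

section Sheafification

open Topology Filter

variable {X : Type u} [TopologicalSpace X]

namespace GrPresheaf

variable {P : GrPresheaf X}

lemma germs_add {k : ℤ} {U : Opens X} (s t : P.sec k U) (y : X) :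
    P.germs (s + t) y = P.germs s y + P.germs t y := by
  by_cases hy : y ∈ U
  · simp only [germs_apply _ hy, map_add]
  · simp only [germs, dif_neg hy, add_zero]

lemma germs_neg {k : ℤ} {U : Opens X} (s : P.sec k U) (y : X) :
    P.germs (-s) y = -P.germs s y := by
  by_cases hy : y ∈ U
  · simp only [germs_apply _ hy, map_neg]
  · simp only [germs, dif_neg hy, neg_zero]

end GrPresheaf

namespace GrModPresheaf

variable {O : GrRingSheaf X} (P : GrModPresheaf O)

lemma isSectionAt_smul {i j k : ℤ} (h : i + j = k) {U : Opens X} (a : O.sec i U) {x : X}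
    (hx : x ∈ U) {φ : ∀ y, P.Stalk j y} (hφ : P.IsSectionAt φ x) {ψ : ∀ y, P.Stalk k y}
    (hψ : ∀ y (hy : y ∈ U), ψ y = P.stalkSmul h a hy (φ y)) : P.IsSectionAt ψ x := by
  obtain ⟨V, hV, hxV, t, ht⟩ := hφ.exists_le hx
  refine ⟨V, hxV, P.smul h (O.res hV a) t, fun y hy => ?_⟩
  rw [hψ y (hV hy), ht y hy, P.stalkSmul_germ h a _ hV]

/-- The value at a point of a section of the associated sheaf. -/
def eval {k : ℤ} {U : Opens X} {x : X} (hx : x ∈ U) : P.sheafify.sec k U →+ P.Stalk k x :=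
  (Pi.evalAddMonoidHom (fun x : U => P.Stalk k x.1) ⟨x, hx⟩).comp (P.sheafSec k U).subtype

/-- The canonical map to the associated sheaf. -/
def toSheafify {k : ℤ} {U : Opens X} : P.sec k U →+ P.sheafify.sec k U where
  toFun p := (⟨fun x => P.germ x.2 p, fun x => ⟨U, x.2, le_rfl, p, fun _ _ => rfl⟩⟩ :
    P.sheafSec k U)
  map_zero' := Subtype.ext (funext fun _ => map_zero _)
  map_add' _ _ := Subtype.ext (funext fun _ => map_add _ _ _)

lemma eval_ext {k : ℤ} {U : Opens X} {s t : P.sheafify.sec k U}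
    (h : ∀ x (hx : x ∈ U), P.eval hx s = P.eval hx t) : s = t :=
  Subtype.ext (funext fun x => h x.1 x.2)

lemma toSheafify_res {k : ℤ} {U V : Opens X} (hV : V ≤ U) (p : P.sec k U) :
    P.toSheafify (P.res hV p) = P.sheafify.res hV (P.toSheafify p) :=
  P.eval_ext fun _ _ => P.germ_res _ _ _

lemma toSheafify_smul {i j k : ℤ} (h : i + j = k) {U : Opens X} (a : O.sec i U)
    (p : P.sec j U) : P.toSheafify (P.smul h a p) = P.sheafify.smul h a (P.toSheafify p) :=
  P.eval_ext fun _ _ => P.germ_smul _ _ _ _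

lemma exists_toSheafify {k : ℤ} {U : Opens X} (s : P.sheafify.sec k U) {x : X} (hx : x ∈ U) :
    ∃ (V : Opens X) (hV : V ≤ U) (_ : x ∈ V) (p : P.sec k V),
      P.sheafify.res hV s = P.toSheafify p := by
  obtain ⟨V, hxV, hV, p, hp⟩ := s.2 ⟨x, hx⟩
  exact ⟨V, hV, hxV, p, P.eval_ext hp⟩

end GrModPresheaf

/-! ### Maps out of tensor products and their stalks. -/

namespace tensorPresheaf

variable {O O' : GrRingSheaf X} (φ : O.Hom O') (F : GrModSheaf O)

/-- The section `a ⊗ s`. -/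
def tprod {i j k : ℤ} (h : i + j = k) {U : Opens X} (a : O'.sec i U) :
    F.sec j U →+ (tensorPresheaf φ F).sec k U :=
  AddMonoidHom.mk' (TensorSec.tmul φ F h a) (TensorSec.tmul_add_right φ h a)

lemma res_tprod {i j k : ℤ} (h : i + j = k) {U V : Opens X} (hV : V ≤ U) (a : O'.sec i U)
    (s : F.sec j U) : (tensorPresheaf φ F).res hV (tprod φ F h a s)
      = tprod φ F h (O'.res hV a) (F.res hV s) :=
  TensorSec.res_tmul ..

lemma smul_tprod {l i m il j k : ℤ} (hk : l + m = k) (h : i + j = m) (h₁ : l + i = il)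
    (h₂ : il + j = k) {U : Opens X} (b : O'.sec l U) (a : O'.sec i U) (s : F.sec j U) :
    (tensorPresheaf φ F).smul hk b (tprod φ F h a s) = tprod φ F h₂ (O'.mul h₁ b a) s :=
  TensorSec.smul_tmul φ F hk h h₁ h₂ b a s

lemma mul_tprod {i l j il lj k : ℤ} (h₁ : i + l = il) (h₂ : il + j = k) (h₃ : l + j = lj)
    (h₄ : i + lj = k) {U : Opens X} (a : O'.sec i U) (r : O.sec l U) (s : F.sec j U) :
    tprod φ F h₂ (O'.mul h₁ a (φ.toFun r)) s = tprod φ F h₄ a (F.smul h₃ r s) :=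
  TensorSec.tmul_balance φ h₁ h₂ h₃ h₄ a r s

variable {φ F}

lemma hom_ext {k : ℤ} {U : Opens X} {A : Type u} [AddCommGroup A]
    {f g : (tensorPresheaf φ F).sec k U →+ A}
    (H : ∀ {i j : ℤ} (h : i + j = k) (a : O'.sec i U) (s : F.sec j U),
      f (tprod φ F h a s) = g (tprod φ F h a s)) : f = g :=
  TensorSec.hom_ext φ H

lemma induction {k : ℤ} {U : Opens X} {C : (tensorPresheaf φ F).sec k U → Prop}
    (tprod : ∀ {i j : ℤ} (h : i + j = k) (a : O'.sec i U) (s : F.sec j U), C (tprod φ F h a s))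
    (zero : C 0) (add : ∀ z w, C z → C w → C (z + w)) (neg : ∀ z, C z → C (-z))
    (z : (tensorPresheaf φ F).sec k U) : C z := by
  induction z using QuotientAddGroup.induction_on with
  | H z =>
    induction z using FreeAbelianGroup.induction_on with
    | zero => exact zero
    | of g => exact tprod g.deg g.coeff g.val
    | neg g h => exact neg _ h
    | add z w hz hw => exact add _ _ hz hw

variable (φ F)

/-- Homomorphisms out of the stalks of the tensor product. -/
def stalkDesc {k : ℤ} {y : X} {A : Type u} [AddCommGroup A]
    (f : ∀ {V : Opens X} (_ : y ∈ V) {i j : ℤ}, i + j = k → O'.sec i V → F.sec j V → A)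
    (hl : ∀ {V : Opens X} (hV : y ∈ V) {i j : ℤ} (h : i + j = k) a b s,
      f hV h (a + b) s = f hV h a s + f hV h b s)
    (hr : ∀ {V : Opens X} (hV : y ∈ V) {i j : ℤ} (h : i + j = k) a s t,
      f hV h a (s + t) = f hV h a s + f hV h a t)
    (hb : ∀ {V : Opens X} (hV : y ∈ V) {i l j il lj : ℤ} (h₁ : i + l = il) (h₂ : il + j = k)
      (h₃ : l + j = lj) (h₄ : i + lj = k) a r s,
      f hV h₂ (O'.mul h₁ a (φ.toFun r)) s = f hV h₄ a (F.smul h₃ r s))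
    (hres : ∀ {U V : Opens X} (hVU : V ≤ U) (hV : y ∈ V) {i j : ℤ} (h : i + j = k) a s,
      f hV h (O'.res hVU a) (F.res hVU s) = f (hVU hV) h a s) :
    (tensorPresheaf φ F).Stalk k y →+ A :=
  (tensorPresheaf φ F).stalkLift
    (fun _ hV => TensorSec.lift φ (f hV) (hl hV) (hr hV) (hb hV))
    (fun {U V} hVU hV p => by
      refine DFunLike.congr_fun (f := AddMonoidHom.comp
        (TensorSec.lift φ (f hV) (hl hV) (hr hV) (hb hV)) (TensorSec.res φ F hVU)) ?_ p
      refine TensorSec.hom_ext _ fun {i j} h a s => ?_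
      rw [AddMonoidHom.comp_apply, TensorSec.res_tmul, TensorSec.lift_tmul, TensorSec.lift_tmul,
        hres])

lemma stalkDesc_germ_tprod {k : ℤ} {y : X} {A : Type u} [AddCommGroup A]
    (f : ∀ {V : Opens X} (_ : y ∈ V) {i j : ℤ}, i + j = k → O'.sec i V → F.sec j V → A)
    (hl) (hr) (hb) (hres) {V : Opens X} (hV : y ∈ V) {i j : ℤ} (h : i + j = k)
    (a : O'.sec i V) (s : F.sec j V) :
    stalkDesc φ F f hl hr hb hres ((tensorPresheaf φ F).germ hV (tprod φ F h a s))
      = f hV h a s :=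
  (GrPresheaf.stalkLift_germ _ _ _ hV _).trans (TensorSec.lift_tmul ..)

variable {φ F}

/-- A family of maps of stalks out of a tensor product takes sections to sections if it does so
for the sections `a ⊗ s`. -/
lemma isRegularAt_of_tprod {O'' : GrRingSheaf X} {G : GrModSheaf O''} {k l : ℤ} {x : X}
    {f : ∀ y, (tensorPresheaf φ F).Stalk k y →+ G.Stalk l y}
    (H : ∀ {U : Opens X} {i j : ℤ} (h : i + j = k) (a : O'.sec i U) (s : F.sec j U), x ∈ U →
      G.IsSectionAt (fun y => f y ((tensorPresheaf φ F).germs (tprod φ F h a s) y)) x) :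
    GrPresheaf.IsRegularAt (P := (tensorPresheaf φ F).toGrPresheaf) (Q := G.toGrPresheaf)
      f x := by
  refine GrPresheaf.isRegularAt_of_germs fun U s hx => ?_
  induction s using tensorPresheaf.induction with
  | tprod h a b => exact H h a b hx
  | zero =>
    refine GrPresheaf.IsSectionAt.zero.congr ?_
    filter_upwards [U.isOpen.mem_nhds hx] with y hy
    rw [GrPresheaf.germs_apply _ hy, map_zero, map_zero]
  | add z w hz hw =>
    refine (hz.add hw).congr (.of_forall fun y => ?_)
    rw [← map_add, GrPresheaf.germs_add]
  | neg z hz =>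
    refine hz.neg.congr (.of_forall fun y => ?_)
    rw [← map_neg, GrPresheaf.germs_neg]

end tensorPresheaf

namespace GrModSheaf

variable {O : GrRingSheaf X} {B : GrModSheaf O} {U : Opens X} {r : ℤ → ℕ}
  {e : ∀ j : (Σ i : ℤ, Fin (r i)), B.sec j.1 U}

lemma isFrame_of_frameSum
    (hinj : ∀ (k : ℤ) {V : Opens X} (hV : V ≤ U) c, frameSum e k hV c = 0 → c = 0)
    (hspan : ∀ (k : ℤ) {V : Opens X} (hV : V ≤ U) (s : B.sec k V), ∀ x ∈ V,
      ∃ (W : Opens X) (hW : W ≤ V) (_ : x ∈ W) (c : _),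
        B.res hW s = frameSum e k (hW.trans hV) c) : B.IsFrame U r e := by
  classical
  refine fun V hV k => ⟨fun t c h j hj => ?_, fun s x hx => ?_⟩
  · have h0 := hinj k hV (∑ j ∈ t, DFinsupp.single j (c j)) (by
      rw [map_sum, ← h]
      exact Finset.sum_congr rfl fun j _ => frameSum_single ..)
    have := DFunLike.congr_fun h0 j
    rw [DFinsupp.finsetSum_apply, Finset.sum_eq_single_of_mem j hj] at this
    · simpa using this
    · intro l _ hl
      exact DFinsupp.single_eq_of_ne hl.symm
  · obtain ⟨W, hW, hxW, c, hc⟩ := hspan k hV s x hx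
    refine ⟨W, hW, hxW, c.support, c, ?_⟩
    rw [hc, frameSum, DFinsupp.sumAddHom_apply]
    rfl

end GrModSheaf

end Sheafification

/-! ## The standard graded vector bundle -/

section Standard

open Topology Filter

variable {n : ℕ} {M : Type u} [TopologicalSpace M] [ChartedSpace (EuclideanSpace ℝ (Fin n)) M]
  {𝓜 : NManifold n M}

namespace NManifold

lemma proj_eq_zero {k : ℤ} (hk : k ≠ 0) {U : Opens M} (a : (smoothSheafGr n M).sec k U) :
    𝓜.proj.toFun a = 0 := by
  change 𝓜.projAux k U a.1 = 0
  rw [𝓜.projAux_ne hk]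
  rfl

lemma smooth_eq_zero {k : ℤ} (hk : k ≠ 0) {U : Opens M} (a : (smoothSheafGr n M).sec k U) :
    a = 0 := Subtype.ext (a.2 hk)

lemma proj_zeroEmb {U : Opens M} (a : 𝓜.sec 0 U) : 𝓜.proj.toFun (𝓜.zeroEmb.toFun a) = a :=
  (𝓜.fn U).apply_symm_apply a

lemma zeroEmb_proj {k : ℤ} {U : Opens M} (a : (smoothSheafGr n M).sec k U) :
    𝓜.zeroEmb.toFun (𝓜.proj.toFun a) = a := by
  by_cases hk : k = 0
  · subst hk
    exact Subtype.ext ((𝓜.fn U).symm_apply_apply a.1)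
  · rw [proj_eq_zero hk, map_zero, smooth_eq_zero hk a]

variable {B : GrModSheaf 𝓜.toGrRingSheaf}
  {P : ∀ (_m k : ℤ) (y : M), B.Stalk k y →+ B.Stalk k y}

/-- The homomorphism `f ⊗ b ↦ f (P b)` from the stalk of the standard bundle. -/
def sigma {y : M} (hP : B.IsSplittingAt P y) (k : ℤ) :
    (tensorPresheaf 𝓜.zeroEmb B).Stalk k y →+ B.Stalk k y :=
  tensorPresheaf.stalkDesc 𝓜.zeroEmb B
    (fun {V} hV {i j} h a b => B.stalkSmul h (𝓜.proj.toFun a) hV (P k j y (B.germ hV b)))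
    (fun {V} hV {i j} h a b s => by rw [map_add, B.stalkSmul_add])
    (fun {V} hV {i j} h a s t => by rw [map_add, map_add, map_add])
    (fun {V} hV {i l j il lj} h₁ h₂ h₃ h₄ a r s => by
      rw [𝓜.proj.map_mul, B.stalkSmul_mul h₁ h₂ h₃ h₄, B.germ_smul, hP.map_smul]
      -- Only `l > 0` needs an argument, as `0^* r` then vanishes but `r` may not. If `i = 0` then
      -- `b` has degree `j < k` and `P k` kills it; if `i ≠ 0` then `a` is zero.
      rcases lt_trichotomy l 0 with hl | rfl | hl
      · rw [𝓜.nonneg l hl V r, map_zero, map_zero]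
      · rw [proj_zeroEmb]
      · by_cases hi : i = 0
        · rw [hP.eq_zero (show j < k by omega), map_zero, map_zero, map_zero, map_zero]
        · rw [proj_eq_zero hi, B.stalkSmul_zero, B.stalkSmul_zero])
    (fun {U V} hVU hV {i j} h a s => by rw [𝓜.proj.map_res, B.stalkSmul_res, B.germ_res])

lemma sigma_germ_tprod {y : M} (hP : B.IsSplittingAt P y) {i j k : ℤ} (h : i + j = k)
    {V : Opens M} (hV : y ∈ V) (a : (smoothSheafGr n M).sec i V) (b : B.sec j V) :
    sigma hP k ((tensorPresheaf 𝓜.zeroEmb B).germ hV (tensorPresheaf.tprod 𝓜.zeroEmb B h a b))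
      = B.stalkSmul h (𝓜.proj.toFun a) hV (P k j y (B.germ hV b)) :=
  tensorPresheaf.stalkDesc_germ_tprod ..

lemma sigma_smul {y : M} (hP : B.IsSplittingAt P y) {l m k : ℤ} (h : l + m = k) {U : Opens M}
    (hU : y ∈ U) (f : (smoothSheafGr n M).sec l U)
    (τ : (tensorPresheaf 𝓜.zeroEmb B).Stalk m y) :
    sigma hP k ((tensorPresheaf 𝓜.zeroEmb B).stalkSmul h f hU τ)
      = B.stalkSmul h (𝓜.proj.toFun f) hU (sigma hP m τ) := by
  by_cases hl : l = 0
  · subst hl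
    obtain rfl : m = k := by omega
    obtain ⟨V, hV, hyV, p, rfl⟩ := (tensorPresheaf 𝓜.zeroEmb B).exists_germ_le hU τ
    rw [(tensorPresheaf 𝓜.zeroEmb B).stalkSmul_germ h f hU hV hyV]
    refine DFunLike.congr_fun (f := ((sigma hP m).comp ((tensorPresheaf 𝓜.zeroEmb B).germ hyV)).comp
      ((tensorPresheaf 𝓜.zeroEmb B).smul h ((smoothSheafGr n M).res hV f)))
      (g := ((B.stalkSmul h (𝓜.proj.toFun f) hU).comp (sigma hP m)).comp
        ((tensorPresheaf 𝓜.zeroEmb B).germ hyV)) ?_ p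
    refine tensorPresheaf.hom_ext fun {i j} h' a s => ?_
    simp only [AddMonoidHom.comp_apply]
    rw [tensorPresheaf.smul_tprod 𝓜.zeroEmb B h h' (zero_add i) h', sigma_germ_tprod,
      sigma_germ_tprod, 𝓜.proj.map_mul, B.stalkSmul_mul (zero_add i) h' h' h, 𝓜.proj.map_res,
      B.stalkSmul_res]
  · rw [smooth_eq_zero hl f, map_zero, GrModPresheaf.stalkSmul_zero,
      GrModPresheaf.stalkSmul_zero, map_zero]

lemma isRegularAt_sigma (hP : ∀ y, B.IsRegularSplittingAt P y) (k : ℤ) (x : M) :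
    GrPresheaf.IsRegularAt (P := (tensorPresheaf 𝓜.zeroEmb B).toGrPresheaf)
      (Q := B.toGrPresheaf) (fun y => sigma (hP y).toIsSplittingAt k) x := by
  refine tensorPresheaf.isRegularAt_of_tprod fun {U i j} h a b hx => ?_
  refine B.isSectionAt_smul h (𝓜.proj.toFun a) hx
    ((hP x).isRegularAt k j _ (GrPresheaf.isSectionAt_germs b hx)) fun y hy => ?_
  rw [GrPresheaf.germs_apply _ hy, GrPresheaf.germs_apply _ hy, sigma_germ_tprod]

/-- The section `1 ⊗ b` of the standard bundle. -/
def standardSec (B : GrModSheaf 𝓜.toGrRingSheaf) {k : ℤ} {U : Opens M} :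
    B.sec k U →+ (B.pullback 𝓜.zeroEmb).sec k U :=
  (tensorPresheaf 𝓜.zeroEmb B).toSheafify.comp
    (tensorPresheaf.tprod 𝓜.zeroEmb B (zero_add k) ((smoothSheafGr n M).one U))

/-- The value at `y` of a section of the standard bundle, as a germ of `B`. -/
def sigmaEval {y : M} (hP : B.IsSplittingAt P y) {k : ℤ} {U : Opens M} (hy : y ∈ U) :
    (B.pullback 𝓜.zeroEmb).sec k U →+ B.Stalk k y :=
  (sigma hP k).comp ((tensorPresheaf 𝓜.zeroEmb B).eval hy)

lemma sigmaEval_res {y : M} (hP : B.IsSplittingAt P y) {k : ℤ} {U V : Opens M} (hV : V ≤ U)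
    (hy : y ∈ V) (s : (B.pullback 𝓜.zeroEmb).sec k U) :
    sigmaEval hP hy ((B.pullback 𝓜.zeroEmb).res hV s) = sigmaEval hP (hV hy) s := rfl

lemma sigmaEval_smul {y : M} (hP : B.IsSplittingAt P y) {i j k : ℤ} (h : i + j = k)
    {U : Opens M} (hy : y ∈ U) (f : (smoothSheafGr n M).sec i U)
    (s : (B.pullback 𝓜.zeroEmb).sec j U) :
    sigmaEval hP hy ((B.pullback 𝓜.zeroEmb).smul h f s)
      = B.stalkSmul h (𝓜.proj.toFun f) hy (sigmaEval hP hy s) :=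
  sigma_smul hP h hy f _

lemma sigmaEval_standardSec {y : M} (hP : B.IsSplittingAt P y) {k : ℤ} {U : Opens M} (hy : y ∈ U)
    (b : B.sec k U) : sigmaEval hP hy (standardSec B b) = P k k y (B.germ hy b) := by
  change sigma hP k ((tensorPresheaf 𝓜.zeroEmb B).germ hy _) = _
  rw [sigma_germ_tprod, 𝓜.proj.map_one, B.stalkSmul_one]

lemma res_standardSec {k : ℤ} {U V : Opens M} (hV : V ≤ U) (b : B.sec k U) :
    (B.pullback 𝓜.zeroEmb).res hV (standardSec B b) = standardSec B (B.res hV b) := by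
  refine ((tensorPresheaf 𝓜.zeroEmb B).toSheafify_res hV _).symm.trans ?_
  rw [tensorPresheaf.res_tprod, GrRingSheaf.res_one]
  rfl

/-- Both sides come from moving `a` across the tensor sign: `0^*(a) ⊗ b = 1 ⊗ a b`. -/
lemma smul_standardSec {i j k : ℤ} (h : i + j = k) {U : Opens M} (a : 𝓜.sec i U)
    (b : B.sec j U) : (B.pullback 𝓜.zeroEmb).smul h (𝓜.zeroEmb.toFun a) (standardSec B b)
      = standardSec B (B.smul h a b) := by
  refine ((tensorPresheaf 𝓜.zeroEmb B).toSheafify_smul h _ _).symm.trans ?_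
  rw [tensorPresheaf.smul_tprod 𝓜.zeroEmb B h (zero_add j) (add_zero i) h, GrRingSheaf.mul_one]
  change _ = (tensorPresheaf 𝓜.zeroEmb B).toSheafify _
  rw [← tensorPresheaf.mul_tprod 𝓜.zeroEmb B (zero_add i) h h (zero_add k), GrRingSheaf.one_mul]

/-- Sections of the standard bundle are locally of the form `1 ⊗ b`. -/
lemma exists_standardSec {k : ℤ} {U : Opens M} (s : (B.pullback 𝓜.zeroEmb).sec k U) {x : M}
    (hx : x ∈ U) : ∃ (V : Opens M) (hV : V ≤ U) (_ : x ∈ V) (b : B.sec k V),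
      (B.pullback 𝓜.zeroEmb).res hV s = standardSec B b := by
  obtain ⟨V, hV, hxV, p, hp⟩ := (tensorPresheaf 𝓜.zeroEmb B).exists_toSheafify s hx
  suffices ∃ b : B.sec k V, p = tensorPresheaf.tprod 𝓜.zeroEmb B (zero_add k)
      ((smoothSheafGr n M).one V) b by
    obtain ⟨b, rfl⟩ := this
    exact ⟨V, hV, hxV, b, hp⟩
  clear hp
  induction p using tensorPresheaf.induction with
  | tprod h a b =>
    refine ⟨B.smul h (𝓜.proj.toFun a) b, ?_⟩
    rw [← tensorPresheaf.mul_tprod 𝓜.zeroEmb B (zero_add _) h h (zero_add k),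
      GrRingSheaf.one_mul, zeroEmb_proj]
  | zero => exact ⟨0, (map_zero _).symm⟩
  | add z w hz hw =>
    obtain ⟨b, rfl⟩ := hz
    obtain ⟨c, rfl⟩ := hw
    exact ⟨b + c, (map_add _ _ _).symm⟩
  | neg z hz =>
    obtain ⟨b, rfl⟩ := hz
    exact ⟨-b, (map_neg _ _).symm⟩

end NManifold

end Standard

/-! ### The isomorphism of `π^* 0^* B` with `B` defined by a splitting. -/

section Main

open Topology Filter

variable {n : ℕ} {M : Type u} [TopologicalSpace M] [ChartedSpace (EuclideanSpace ℝ (Fin n)) M]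
  {𝓜 : NManifold n M}

namespace NManifold

variable {B : GrModSheaf 𝓜.toGrRingSheaf}
  {P : ∀ (_m k : ℤ) (y : M), B.Stalk k y →+ B.Stalk k y}

lemma proj_injective {k : ℤ} {U : Opens M} {a : (smoothSheafGr n M).sec k U}
    (h : 𝓜.proj.toFun a = 0) : a = 0 := by
  rw [← zeroEmb_proj (𝓜 := 𝓜) a, h, map_zero]

section Frame

variable {U : Opens M} {r : ℤ → ℕ} {e : ∀ j : (Σ i : ℤ, Fin (r i)), B.sec j.1 U}

/-- A frame of `B` induces a frame of the standard bundle. -/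
theorem isFrame_standardSec (he : B.IsFrame U r e) :
    (B.pullback 𝓜.zeroEmb).IsFrame U r fun j => standardSec B (e j) := by
  refine GrModSheaf.isFrame_of_frameSum (fun k V hV c hc => ?_) fun k V hV s x hx => ?_
  · let c' : Π₀ j : (Σ i : ℤ, Fin (r i)), 𝓜.sec (k - j.1) V :=
      DFinsupp.mapRange.addMonoidHom (fun _ => 𝓜.proj.toFun) c
    have hc' : GrModSheaf.frameSum e k hV c' = 0 := by
      refine B.isSheaf.eq_of_germ_eq _ _ fun y hy => ?_
      have hP := he.isSplittingAt_proj 𝓜.nonneg (hV hy)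
      rw [map_zero, ← map_zero (sigmaEval hP hy), ← hc]
      refine DFunLike.congr_fun (f := ((B.germ hy).comp (GrModSheaf.frameSum e k hV)).comp
        (DFinsupp.mapRange.addMonoidHom fun _ => 𝓜.proj.toFun))
        (g := (sigmaEval hP hy).comp (GrModSheaf.frameSum _ k hV)) ?_ c
      refine DFinsupp.addHom_ext fun j a => ?_
      simp only [AddMonoidHom.comp_apply]
      rw [DFinsupp.mapRange.addMonoidHom_apply, DFinsupp.mapRange_single,
        GrModSheaf.frameSum_single, GrModSheaf.frameSum_single, B.germ_smul, sigmaEval_smul,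
        sigmaEval_res, sigmaEval_standardSec, B.germ_res, he.proj_germ_self]
    have hc0 : c' = 0 := he.frameSum_injective k hV (hc'.trans (map_zero _).symm)
    ext1 j
    exact proj_injective (DFunLike.congr_fun hc0 j)
  -- A section is locally `1 ⊗ b`; expanding `b` in the frame and applying `0^*` to the coefficients
  -- expands the section.
  · obtain ⟨V', hV', hxV', b, hb⟩ := exists_standardSec s hx
    obtain ⟨W, hW, hxW, c, hc⟩ := he.exists_frameSum (hV'.trans hV) b hxV'
    refine ⟨W, hW.trans hV', hxW, DFinsupp.mapRange.addMonoidHom (fun _ => 𝓜.zeroEmb.toFun) c, ?_⟩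
    rw [← GrPresheaf.res_res _ hV' hW, hb, res_standardSec, hc]
    refine DFunLike.congr_fun (f := (standardSec B).comp (GrModSheaf.frameSum e k _))
      (g := (GrModSheaf.frameSum (fun j => standardSec B (e j)) k _).comp
        (DFinsupp.mapRange.addMonoidHom fun _ => 𝓜.zeroEmb.toFun)) ?_ c
    refine DFinsupp.addHom_ext fun j a => ?_
    simp only [AddMonoidHom.comp_apply]
    rw [DFinsupp.mapRange.addMonoidHom_apply, DFinsupp.mapRange_single,
      GrModSheaf.frameSum_single, GrModSheaf.frameSum_single, res_standardSec, smul_standardSec]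

end Frame

/-- The homomorphism `a ⊗ s ↦ a σ(s)` on the stalks of `π^* 0^* B`. -/
def psi {y : M} (hP : B.IsSplittingAt P y) (k : ℤ) :
    (tensorPresheaf 𝓜.proj (B.pullback 𝓜.zeroEmb)).Stalk k y →+ B.Stalk k y :=
  tensorPresheaf.stalkDesc 𝓜.proj (B.pullback 𝓜.zeroEmb)
    (fun {V} hV {i j} h a s => B.stalkSmul h a hV (sigmaEval hP hV s))
    (fun {V} hV {i j} h a b s => by rw [B.stalkSmul_add])
    (fun {V} hV {i j} h a s t => by rw [map_add, map_add])
    (fun {V} hV {i l j il lj} h₁ h₂ h₃ h₄ a r s => by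
      rw [B.stalkSmul_mul h₁ h₂ h₃ h₄, sigmaEval_smul])
    (fun {U V} hVU hV {i j} h a s => by rw [B.stalkSmul_res, sigmaEval_res])

lemma psi_germ_tprod {y : M} (hP : B.IsSplittingAt P y) {i j k : ℤ} (h : i + j = k)
    {V : Opens M} (hV : y ∈ V) (a : 𝓜.sec i V) (s : (B.pullback 𝓜.zeroEmb).sec j V) :
    psi hP k ((tensorPresheaf 𝓜.proj (B.pullback 𝓜.zeroEmb)).germ hV
      (tensorPresheaf.tprod 𝓜.proj (B.pullback 𝓜.zeroEmb) h a s))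
      = B.stalkSmul h a hV (sigmaEval hP hV s) :=
  tensorPresheaf.stalkDesc_germ_tprod ..

lemma psi_smul {y : M} (hP : B.IsSplittingAt P y) {l m k : ℤ} (h : l + m = k) {U : Opens M}
    (hU : y ∈ U) (f : 𝓜.sec l U)
    (τ : (tensorPresheaf 𝓜.proj (B.pullback 𝓜.zeroEmb)).Stalk m y) :
    psi hP k ((tensorPresheaf 𝓜.proj (B.pullback 𝓜.zeroEmb)).stalkSmul h f hU τ)
      = B.stalkSmul h f hU (psi hP m τ) := by
  obtain ⟨V, hV, hyV, p, rfl⟩ :=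
    (tensorPresheaf 𝓜.proj (B.pullback 𝓜.zeroEmb)).exists_germ_le hU τ
  rw [(tensorPresheaf 𝓜.proj (B.pullback 𝓜.zeroEmb)).stalkSmul_germ h f hU hV hyV]
  refine DFunLike.congr_fun
    (f := ((psi hP k).comp ((tensorPresheaf 𝓜.proj (B.pullback 𝓜.zeroEmb)).germ hyV)).comp
      ((tensorPresheaf 𝓜.proj (B.pullback 𝓜.zeroEmb)).smul h (𝓜.res hV f)))
    (g := ((B.stalkSmul h f hU).comp (psi hP m)).comp
      ((tensorPresheaf 𝓜.proj (B.pullback 𝓜.zeroEmb)).germ hyV)) ?_ p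
  refine tensorPresheaf.hom_ext fun {i j} h' a s => ?_
  have hk : l + i + j = k := by omega
  simp only [AddMonoidHom.comp_apply]
  rw [tensorPresheaf.smul_tprod 𝓜.proj _ h h' rfl hk, psi_germ_tprod, psi_germ_tprod,
    B.stalkSmul_mul rfl hk h' h, B.stalkSmul_res]

lemma isRegularAt_psi (hP : ∀ y, B.IsRegularSplittingAt P y) (k : ℤ) (x : M) :
    GrPresheaf.IsRegularAt
      (P := (tensorPresheaf 𝓜.proj (B.pullback 𝓜.zeroEmb)).toGrPresheaf)
      (Q := B.toGrPresheaf) (fun y => psi (hP y).toIsSplittingAt k) x := by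
  refine tensorPresheaf.isRegularAt_of_tprod fun {U i j} h a s hx => ?_
  obtain ⟨V, hxV, hV, p, hp⟩ := s.2 ⟨x, hx⟩
  refine B.isSectionAt_smul h (𝓜.res hV a) hxV (isRegularAt_sigma hP j x _
    (GrPresheaf.isSectionAt_germs p hxV)) fun y hy => ?_
  rw [GrPresheaf.germs_apply _ (hV hy), psi_germ_tprod, B.stalkSmul_res,
    GrPresheaf.germs_apply _ hy, ← hp y hy]
  rfl

/-- Each `z` is a finite sum of elements `P m z = P m (P m z)` with `P m z` generated in degrees at
most `m`. On a generator `a w`, `P m` gives zero if `w` has degree below `m`, and `a P m w`, the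
image of `a ⊗ (1 ⊗ w)`, if the degree is `m`. -/
lemma psi_surjective {y : M} (hP : B.IsSplittingAt P y) (k : ℤ) :
    Function.Surjective (psi hP k) := by
  intro z
  rw [← AddMonoidHom.mem_range]
  obtain ⟨T, hT⟩ := (hP.isResolution k).exists_sum z
  rw [← hT]
  refine AddSubgroup.sum_mem _ fun m _ => ?_
  have key : B.filtration m k y ≤ (psi hP k).range.comap (P m k y) := by
    rw [GrModSheaf.filtration, AddSubgroup.closure_le]
    rintro _ ⟨i, j, h, hj, U, hy, a, w, rfl⟩
    change P m k y _ ∈ (psi hP k).range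
    rw [hP.map_smul]
    rcases hj.lt_or_eq with hj | rfl
    · rw [hP.eq_zero hj, map_zero]
      exact AddSubgroup.zero_mem _
    · obtain ⟨V, hV, hyV, b, rfl⟩ := B.exists_germ_le hy w
      refine ⟨(tensorPresheaf 𝓜.proj (B.pullback 𝓜.zeroEmb)).germ hyV
        (tensorPresheaf.tprod 𝓜.proj (B.pullback 𝓜.zeroEmb) h (𝓜.res hV a)
          (standardSec B b)), ?_⟩
      rw [psi_germ_tprod, sigmaEval_standardSec, B.stalkSmul_res]
  rw [← (hP.isResolution k).idem m z]
  exact key (hP.mem m k z)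

section Frame

variable {U : Opens M} {r : ℤ → ℕ} {e : ∀ j : (Σ i : ℤ, Fin (r i)), B.sec j.1 U}

/-- The section `∑ c j ⊗ (1 ⊗ e j)` of `π^* 0^* B`. -/
def tensorFrameSum (e : ∀ j : (Σ i : ℤ, Fin (r i)), B.sec j.1 U) (k : ℤ) {V : Opens M}
    (hV : V ≤ U) : (Π₀ j : (Σ i : ℤ, Fin (r i)), 𝓜.sec (k - j.1) V) →+
      (tensorPresheaf 𝓜.proj (B.pullback 𝓜.zeroEmb)).sec k V :=
  DFinsupp.sumAddHom fun j => AddMonoidHom.mk'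
    (fun a => tensorPresheaf.tprod 𝓜.proj _ (sub_add_cancel k j.1) a
      (standardSec B (B.res hV (e j)))) fun a b => TensorSec.tmul_add_left _ _ a b _

lemma tensorFrameSum_single (k : ℤ) {V : Opens M} (hV : V ≤ U) (j : Σ i : ℤ, Fin (r i))
    (a : 𝓜.sec (k - j.1) V) : tensorFrameSum e k hV (DFinsupp.single j a)
      = tensorPresheaf.tprod 𝓜.proj _ (sub_add_cancel k j.1) a
        (standardSec B (B.res hV (e j))) :=
  DFinsupp.sumAddHom_single _ _ _

lemma res_tensorFrameSum (k : ℤ) {V W : Opens M} (hV : V ≤ U) (hW : W ≤ V)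
    (c : Π₀ j : (Σ i : ℤ, Fin (r i)), 𝓜.sec (k - j.1) V) :
    (tensorPresheaf 𝓜.proj (B.pullback 𝓜.zeroEmb)).res hW (tensorFrameSum e k hV c)
      = tensorFrameSum e k (hW.trans hV) (GrModSheaf.resCoeff r k hW c) := by
  refine DFunLike.congr_fun
    (f := ((tensorPresheaf 𝓜.proj (B.pullback 𝓜.zeroEmb)).res hW).comp (tensorFrameSum e k hV))
    (g := (tensorFrameSum e k (hW.trans hV)).comp (GrModSheaf.resCoeff r k hW)) ?_ c
  refine DFinsupp.addHom_ext fun j a => ?_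
  rw [AddMonoidHom.comp_apply, AddMonoidHom.comp_apply, tensorFrameSum_single,
    GrModSheaf.resCoeff, DFinsupp.mapRange.addMonoidHom_apply, DFinsupp.mapRange_single,
    tensorFrameSum_single, tensorPresheaf.res_tprod, res_standardSec, B.res_res]

/-- The `1 ⊗ e j` form a frame of `0^* B`, and smooth coefficients move across the tensor sign into
`𝓜`. -/
lemma exists_tensorFrameSum (he : B.IsFrame U r e) {k : ℤ} {V : Opens M} (hV : V ≤ U)
    (p : (tensorPresheaf 𝓜.proj (B.pullback 𝓜.zeroEmb)).sec k V) {y : M} (hy : y ∈ V) :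
    ∃ (W : Opens M) (hW : W ≤ V) (_ : y ∈ W)
      (c : Π₀ j : (Σ i : ℤ, Fin (r i)), 𝓜.sec (k - j.1) W),
      (tensorPresheaf 𝓜.proj (B.pullback 𝓜.zeroEmb)).res hW p
        = tensorFrameSum e k (hW.trans hV) c := by
  induction p using tensorPresheaf.induction with
  | @tprod i j h a s =>
    obtain ⟨W, hW, hyW, d, hd⟩ := (isFrame_standardSec he).exists_frameSum hV s hy
    refine ⟨W, hW, hyW, DFinsupp.mapRange.addMonoidHom (fun l =>
      (𝓜.mul (show i + (j - l.1) = k - l.1 by omega) (𝓜.res hW a)).comp 𝓜.proj.toFun) d, ?_⟩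
    rw [tensorPresheaf.res_tprod, hd]
    refine DFunLike.congr_fun
      (f := (tensorPresheaf.tprod 𝓜.proj (B.pullback 𝓜.zeroEmb) h (𝓜.res hW a)).comp
        (GrModSheaf.frameSum (fun l => standardSec B (e l)) j _))
      (g := (tensorFrameSum e k _).comp (DFinsupp.mapRange.addMonoidHom _)) ?_ d
    refine DFinsupp.addHom_ext fun l f => ?_
    rw [AddMonoidHom.comp_apply, AddMonoidHom.comp_apply, DFinsupp.mapRange.addMonoidHom_apply,
      DFinsupp.mapRange_single, tensorFrameSum_single, GrModSheaf.frameSum_single,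
      res_standardSec, AddMonoidHom.comp_apply, tensorPresheaf.mul_tprod]
  | zero => exact ⟨V, le_rfl, hy, 0, by rw [map_zero, map_zero]⟩
  | add p q hp hq =>
    obtain ⟨W, hW, hyW, c, hc⟩ := hp
    obtain ⟨W', hW', hyW', c', hc'⟩ := hq
    refine ⟨W ⊓ W', inf_le_left.trans hW, ⟨hyW, hyW'⟩, GrModSheaf.resCoeff r k inf_le_left c
      + GrModSheaf.resCoeff r k inf_le_right c', ?_⟩
    rw [map_add, map_add, ← res_tensorFrameSum k (hW.trans hV),
      ← res_tensorFrameSum k (hW'.trans hV), ← hc, ← hc', GrPresheaf.res_res,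
      GrPresheaf.res_res]
  | neg p hp =>
    obtain ⟨W, hW, hyW, c, hc⟩ := hp
    exact ⟨W, hW, hyW, -c, by rw [map_neg, map_neg, hc]⟩

/-- This is the unitriangularity of `psi`. Writing `Q` for the projections of the frame, linearity
reduces it to `Q m P m P j e = Q m e` for `e = Q j e` of degree `j`: when `m = j` this is `Q m P m Q
m = Q m`, and otherwise both sides vanish. -/
lemma proj_psi_tensorFrameSum (he : B.IsFrame U r e) {y : M} (hP : B.IsSplittingAt P y)
    (m k : ℤ) {V : Opens M} (hV : V ≤ U) (hy : y ∈ V)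
    (c : Π₀ j : (Σ i : ℤ, Fin (r i)), 𝓜.sec (k - j.1) V) :
    he.proj m k y (P m k y (psi hP k
      ((tensorPresheaf 𝓜.proj (B.pullback 𝓜.zeroEmb)).germ hy (tensorFrameSum e k hV c))))
      = he.proj m k y (B.germ hy (GrModSheaf.frameSum e k hV c)) := by
  have hQ := he.isSplittingAt_proj 𝓜.nonneg (hV hy)
  refine DFunLike.congr_fun (f := ((((he.proj m k y).comp (P m k y)).comp (psi hP k)).comp
      ((tensorPresheaf 𝓜.proj (B.pullback 𝓜.zeroEmb)).germ hy)).comp (tensorFrameSum e k hV))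
    (g := ((he.proj m k y).comp (B.germ hy)).comp (GrModSheaf.frameSum e k hV)) ?_ c
  refine DFinsupp.addHom_ext fun j a => ?_
  simp only [AddMonoidHom.comp_apply]
  rw [tensorFrameSum_single, psi_germ_tprod, GrModSheaf.frameSum_single,
    B.germ_smul, sigmaEval_standardSec, hP.map_smul, hQ.map_smul, hQ.map_smul, B.germ_res]
  congr 1
  rw [← he.proj_germ_self j (hV hy)]
  by_cases hj : m = j.1
  · subst hj
    rw [(hP.isResolution _).idem, (hQ.compatible hP j.1).proj_proj_proj (hQ.isResolution _)
      (hP.isResolution _), (hQ.isResolution _).idem]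
  · rw [(hP.isResolution _).orth _ _ _ hj, map_zero, (hQ.isResolution _).orth _ _ _ hj]

/-- If `psi` kills `∑ c j ⊗ (1 ⊗ e j)`, then all frame projections of `∑ c j e j` vanish, so that
sum has zero germ and the coefficients vanish near `y`. -/
lemma psi_injective (he : B.IsFrame U r e) {y : M} (hy : y ∈ U) (hP : B.IsSplittingAt P y)
    (k : ℤ) : Function.Injective (psi hP k) := by
  rw [injective_iff_map_eq_zero]
  intro τ hτ
  obtain ⟨V, hV, hyV, p, rfl⟩ :=
    (tensorPresheaf 𝓜.proj (B.pullback 𝓜.zeroEmb)).exists_germ_le hy τ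
  obtain ⟨W, hW, hyW, c, hc⟩ := exists_tensorFrameSum he hV p hyV
  rw [← GrPresheaf.germ_res _ hW hyW, hc] at hτ ⊢
  have hQ := he.isSplittingAt_proj 𝓜.nonneg hy
  have h0 : B.germ hyW (GrModSheaf.frameSum e k (hW.trans hV) c) = 0 := by
    refine (hQ.isResolution k).eq_of_proj_eq fun m => ?_
    rw [← proj_psi_tensorFrameSum he hP, hτ, map_zero, map_zero]
  obtain ⟨W', hW', hyW', h⟩ := B.exists_res_eq_zero hyW _ h0
  rw [GrModSheaf.res_frameSum] at h
  have h := he.frameSum_injective k _ (h.trans (map_zero _).symm)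
  rw [← GrPresheaf.germ_res _ hW' hyW', res_tensorFrameSum, h, map_zero, map_zero]

end Frame

end NManifold

end Main

end

theorem mainTheorem3 (n : ℕ) (M : Type u) [TopologicalSpace M] [T2Space M]
    [SecondCountableTopology M] [ChartedSpace (EuclideanSpace ℝ (Fin n)) M]
    [IsManifold (𝓡 n) ∞ M] (𝓜 : NManifold n M) (B : 𝓜.VectorBundle)
    (hB : B.DegreeBounded ∨ B.Semibounded) :
    B.standard.IsLocallyFree B.rank ∧
      Nonempty (B.toGrModSheaf.Iso (B.standard.pullback 𝓜.proj)) := by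
  refine ⟨fun x => ?_, ?_⟩
  · obtain ⟨U, hx, e, he⟩ := B.locallyFree x
    exact ⟨U, hx, _, NManifold.isFrame_standardSec he⟩
  -- The local splittings fed into the gluing are those of local frames; frames are used once more
  -- for injectivity at each point.
  · obtain ⟨P, hP⟩ := NManifold.exists_isRegularSplittingAt B.toGrModSheaf fun x => by
      obtain ⟨U, hx, e, he⟩ := B.locallyFree x
      exact ⟨U, he.proj, hx, fun y hy => he.isRegularSplittingAt_proj 𝓜.nonneg hy⟩
    refine B.nonempty_iso_sheafify _ (fun k y => NManifold.psi (hP y).toIsSplittingAt k)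
      (fun k y => ⟨?_, NManifold.psi_surjective _ k⟩)
      (fun h U a x hx z => NManifold.psi_smul _ h hx a z) (NManifold.isRegularAt_psi hP)
    obtain ⟨U, hy, e, he⟩ := B.locallyFree y
    exact NManifold.psi_injective he hy _ k
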